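/- **Species.** A weighted species $\mathcal F^\omega$ assigns to every finite set $U$ a finite set $\mathcal F[U]$ of structures with weights $\omega\colon\mathcal F[U]\to\mathbb R_{\ge 0}$, and functorially to every bijection $\sigma\colon U\to V$ a weight-preserving bijection $\mathcal F[\sigma]\colon\mathcal F[U]\to\mathcal F[V]$. A structure in $\mathcal F[U]$ has size $|U|$. Write $\mathcal F[n]=\mathcal F[\{1,\dots,n\}]$, $\mathscr U(\mathcal F)=\bigsqcup_{n\ge 0}\mathcal F[n]$ and $\mathcal F^\omega(z)=\sum_{F\in\mathscr U(\mathcal F)}\omega(F)z^{|F|}/|F|!$. The derived species is $\mathcal F'[U]=\mathcal F[U\cup\{*\}]$, with the same weights $\omega$ and with the size not counting $*$. If $\mathcal G[\emptyset]=\emptyset$, the composition is $(\mathcal F\circ\mathcal G)[U]=\bigsqcup_\pi \mathcal F[\pi]\times\prod_{Q\in\pi}\mathcal G[Q]$, where $\pi$ runs over the partitions of $U$ into non-empty classes (components), with weight $\mu(F,(G_Q)_{Q\in\pi})=\omega(F)\prod_{Q\in\pi}\nu(G_Q)$. **Class $\mathscr S_d$.** For an integer $d\ge 1$, a power series $g(z)=\sum_n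 g_nz^n$ with non-negative coefficients and radius of convergence $0<\rho<\infty$ belongs to $\mathscr S_d$ if $g_n=0$ whenever $d\nmid n$, $g(\rho)<\infty$, and, as $n\to\infty$ along multiples of $d$, $$\frac{g_n}{g_{n+d}}\to\rho^d,\qquad \frac1{g_n}\sum_{i+j=n}g_ig_j\to 2g(\rho).$$ **Remainder.** Let $\mathcal F^\omega,\mathcal G^\nu$ be weighted species with $\mathcal G[\emptyset]=\emptyset$ and $[z^k]\mathcal F^\omega(z)>0$ for some $k\ge 1$. For $n\ge1$ with $[z^n](\mathcal F^\omega\circ\mathcal G^\nu)(z)>0$, sample $\mathsf S_n=(\mathsf F_n,(\mathsf G_Q)_{Q\in\pi_n})$ from $(\mathcal F\circ\mathcal G)[n]$ with probability proportional to its weight, choose $Q_0$ uniformly at random among the classes of $\pi_n$ of maximal size, relabel the atom $Q_0$ of $\mathsf F_n$ to $*$, delete $\mathsf G_{Q_0}$, and relabel $[n]\setminus Q_0$ by the order-preserving bijection onto $[n-|Q_0|]$. The result is the random structure $\mathsf R_n\in\mathscr U(\mathcal F'\circ\mathcal G)$. **Theorem.** Suppose that $\mathcal G^\nu(z)$ belongs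 to $\mathscr S_d$ with radius of convergence $\rho$, and that $\mathcal F^\omega(z)$ has radius of convergence strictly larger than $\mathcal G^\nu(\rho)$. Then $0<((\mathcal F')^\omega\circ\mathcal G^\nu)(\rho)<\infty$, and $\mathsf R_n$ is defined for all sufficiently large multiples $n$ of $d$. Let $\mathsf R$ be a random element of $\mathscr U(\mathcal F'\circ\mathcal G)$ with the Boltzmann distribution $$\mathbb P(\mathsf R=R)=\frac{\mu(R)\,\rho^{|R|}/|R|!}{((\mathcal F')^\omega\circ\mathcal G^\nu)(\rho)},\qquad R\in\mathscr U(\mathcal F'\circ\mathcal G).$$ Then $$d_{\mathrm{TV}}(\mathsf R_n,\mathsf R)=\sup_{\mathcal E\subseteq\mathscr U(\mathcal F'\circ\mathcal G)}|\mathbb P(\mathsf R_n\in\mathcal E)-\mathbb P(\mathsf R\in\mathcal E)|\to 0,\qquad n\to\infty,\quad n\equiv 0 \bmod d.$$ -/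

import Mathlib

open scoped NNReal ENNReal Nat

universe u v

noncomputable section

/-- A combinatorial species with non-negative weights. Structures on different label sets have
different types, so the disjointness convention `F[U] ∩ F[V] = ∅` for `U ≠ V` is built in. -/
structure WeightedSpecies where
  /-- the structures on a finite label set -/
  obj : (U : Type) → [Finite U] → Type u
  finite_obj : ∀ (U : Type) [Finite U], Finite (obj U)
  /-- transport of structures along a bijection of label sets -/
  map : ∀ {U V : Type} [Finite U] [Finite V], (U ≃ V) → obj U → obj V
  map_refl : ∀ {U : Type} [Finite U] (s : obj U), map (Equiv.refl U) s = s
  map_trans : ∀ {U V W : Type} [Finite U] [Finite V] [Finite W] (σ : U ≃ V) (τ : V ≃ W)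
    (s : obj U), map (σ.trans τ) s = map τ (map σ s)
  /-- the weight of a structure -/
  weight : ∀ {U : Type} [Finite U], obj U → ℝ≥0
  weight_map : ∀ {U V : Type} [Finite U] [Finite V] (σ : U ≃ V) (s : obj U),
    weight (map σ s) = weight s

/-- The unordered partitions of `U` into non-empty classes. -/
def SetPartition (U : Type) : Type := {π : Set (Set U) // Setoid.IsPartition π}

namespace SetPartition

instance (U : Type) [Finite U] : Finite (SetPartition U) :=
  inferInstanceAs (Finite {π : Set (Set U) // Setoid.IsPartition π})

/-- The partition `{σ(Q) | Q ∈ π}`; as `σ` is a bijection, `P` is a class of it iff `σ⁻¹(P) ∈ π`. -/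
def map {U V : Type} (σ : U ≃ V) (π : SetPartition U) : SetPartition V :=
  ⟨{P : Set V | σ ⁻¹' P ∈ π.1}, by
    refine ⟨fun h => π.2.1 (by simpa using h), fun a => ?_⟩
    obtain ⟨Q, ⟨hQ, haQ⟩, huniq⟩ := π.2.2 (σ.symm a)
    refine ⟨σ.symm ⁻¹' Q, ⟨?_, haQ⟩, ?_⟩
    · change σ ⁻¹' (σ.symm ⁻¹' Q) ∈ π.1
      rw [← Set.preimage_comp]
      simpa using hQ
    · rintro P ⟨hP, haP⟩
      have h := huniq (σ ⁻¹' P) ⟨hP, by simpa using haP⟩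
      rw [← h, ← Set.preimage_comp]
      simp⟩

/-- The bijection `π → {σ(Q) | Q ∈ π}`, `Q ↦ σ(Q)`. -/
def mapEquiv {U V : Type} (σ : U ≃ V) (π : SetPartition U) : ↥π.1 ≃ ↥(π.map σ).1 where
  toFun Q := ⟨σ '' Q.1, by
    change σ ⁻¹' (σ '' Q.1) ∈ π.1
    rw [σ.preimage_image]
    exact Q.2⟩
  invFun P := ⟨σ ⁻¹' P.1, P.2⟩
  left_inv Q := Subtype.ext (σ.preimage_image Q.1)
  right_inv P := Subtype.ext (σ.image_preimage P.1)

/-- The partition `π \ {Q₀}` of the complement of the class `Q₀`. -/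
def remove {U : Type} (π : SetPartition U) (Q₀ : ↥π.1) : SetPartition ↥(Q₀.1ᶜ) :=
  ⟨{P : Set ↥(Q₀.1ᶜ) | Subtype.val '' P ∈ π.1}, by
    refine ⟨fun h => π.2.1 (by simpa using h), fun a => ?_⟩
    obtain ⟨Q, ⟨hQ, haQ⟩, huniq⟩ := π.2.2 a.1
    have hne : Q ≠ Q₀.1 := fun h => a.2 (h ▸ haQ)
    have hsub : Q ⊆ Q₀.1ᶜ := fun x hx hx0 =>
      hne ((π.2.2 x).unique ⟨hQ, hx⟩ ⟨Q₀.2, hx0⟩)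
    have him : Subtype.val '' (Subtype.val ⁻¹' Q : Set ↥(Q₀.1ᶜ)) = Q := by
      rw [Subtype.image_preimage_coe]
      exact Set.inter_eq_right.2 hsub
    refine ⟨Subtype.val ⁻¹' Q, ⟨?_, haQ⟩, ?_⟩
    · change Subtype.val '' (Subtype.val ⁻¹' Q : Set ↥(Q₀.1ᶜ)) ∈ π.1
      rw [him]
      exact hQ
    · rintro P ⟨hP, haP⟩
      have h := huniq (Subtype.val '' P) ⟨hP, a, haP, rfl⟩
      rw [← h, Set.preimage_image_eq _ Subtype.val_injective]⟩

/-- The inverse of `γ : π → (π \ {Q₀}) ∪ {*}`: it sends `*` to `Q₀` and fixes all other classes. -/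
def unremove {U : Type} (π : SetPartition U) (Q₀ : ↥π.1) : Option ↥(π.remove Q₀).1 → ↥π.1
  | none => Q₀
  | some P => ⟨Subtype.val '' P.1, P.2⟩

theorem unremove_bijective {U : Type} (π : SetPartition U) (Q₀ : ↥π.1) :
    Function.Bijective (π.unremove Q₀) := by
  have key : ∀ P : ↥(π.remove Q₀).1, π.unremove Q₀ (some P) ≠ Q₀ := by
    intro P h
    obtain ⟨x, hx⟩ := Setoid.nonempty_of_mem_partition (π.remove Q₀).2 P.2
    have h1 : Subtype.val '' P.1 = Q₀.1 := congrArg Subtype.val h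
    have h2 : x.1 ∈ Subtype.val '' P.1 := ⟨x, hx, rfl⟩
    rw [h1] at h2
    exact x.2 h2
  constructor
  · rintro (_ | P) (_ | P') h
    · rfl
    · exact absurd h.symm (key P')
    · exact absurd h (key P)
    · have h1 : Subtype.val '' P.1 = Subtype.val '' P'.1 := congrArg Subtype.val h
      exact congrArg some (Subtype.ext (Subtype.val_injective.image_injective h1))
  · intro Q
    by_cases hne : Q = Q₀
    · exact ⟨none, hne.symm⟩
    · have hsub : Q.1 ⊆ Q₀.1ᶜ := fun x hx hx0 =>
        hne (Subtype.ext ((π.2.2 x).unique ⟨Q.2, hx⟩ ⟨Q₀.2, hx0⟩))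
      have him : Subtype.val '' (Subtype.val ⁻¹' Q.1 : Set ↥(Q₀.1ᶜ)) = Q.1 := by
        rw [Subtype.image_preimage_coe]
        exact Set.inter_eq_right.2 hsub
      refine ⟨some ⟨Subtype.val ⁻¹' Q.1, ?_⟩, Subtype.ext him⟩
      change Subtype.val '' (Subtype.val ⁻¹' Q.1 : Set ↥(Q₀.1ᶜ)) ∈ π.1
      rw [him]
      exact Q.2

/-- The bijection `γ : π → (π \ {Q₀}) ∪ {*}` with `γ(Q₀) = *` and `γ(Q) = Q` for `Q ≠ Q₀`. -/
def removeEquiv {U : Type} (π : SetPartition U) (Q₀ : ↥π.1) :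
    ↥π.1 ≃ Option ↥(π.remove Q₀).1 :=
  (Equiv.ofBijective (π.unremove Q₀) (π.unremove_bijective Q₀)).symm

end SetPartition

namespace WeightedSpecies

attribute [instance] finite_obj

/-- The exponential generating series. -/
def egs (F : WeightedSpecies.{u}) : PowerSeries ℝ :=
  PowerSeries.mk fun n => (∑' s : F.obj (Fin n), (F.weight s : ℝ)) / (n ! : ℝ)

/-- The set `⋃ₙ F[n]` of all structures on the label sets `[n]`, `n ≥ 0`. -/
def Structures (F : WeightedSpecies.{u}) : Type u := Σ n : ℕ, F.obj (Fin n)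

/-- The derived species: `F'[U] = F[U ∪ {*}]`. -/
def derived (F : WeightedSpecies.{u}) : WeightedSpecies.{u} where
  obj U _ := F.obj (Option U)
  finite_obj U _ := F.finite_obj (Option U)
  map σ s := F.map (Equiv.optionCongr σ) s
  map_refl s := by rw [Equiv.optionCongr_refl]; exact F.map_refl s
  map_trans σ τ s := by
    have h : Equiv.optionCongr (σ.trans τ)
        = (Equiv.optionCongr σ).trans (Equiv.optionCongr τ) := by
      ext1 x
      cases x <;> rfl
    rw [h]
    exact F.map_trans _ _ s
  weight s := F.weight s
  weight_map σ s := F.weight_map _ s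

section Comp

variable (F : WeightedSpecies.{u}) (G : WeightedSpecies.{v})

/-- Composite structures: a partition `π` of `U`, an `F`-structure on `π`, and a `G`-structure
on every class of `π`. -/
structure CompObj (U : Type) [Finite U] : Type (max u v) where
  /-- the partition -/
  part : SetPartition U
  /-- the structure on the set of classes -/
  outer : F.obj ↥part.1
  /-- the structures on the classes -/
  inner : ∀ Q : ↥part.1, G.obj ↥Q.1

variable {F G}

/-- The restriction `σ⁻¹(P) → P` of a bijection `σ`. -/
def restrictEquiv {U V : Type} (σ : U ≃ V) (P : Set V) : ↥(σ ⁻¹' P) ≃ ↥P :=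
  σ.subtypeEquiv fun _ => Iff.rfl

/-- Transport of composite structures along a bijection. -/
def CompObj.map {U V : Type} [Finite U] [Finite V] (σ : U ≃ V) (s : CompObj F G U) :
    CompObj F G V where
  part := s.part.map σ
  outer := F.map (s.part.mapEquiv σ) s.outer
  inner P := G.map (restrictEquiv σ P.1) (s.inner ⟨σ ⁻¹' P.1, P.2⟩)

/-- The weight of a composite structure. -/
def CompObj.weight {U : Type} [Finite U] (s : CompObj F G U) : ℝ≥0 :=
  F.weight s.outer * ∏ᶠ Q : ↥s.part.1, G.weight (s.inner Q)

theorem CompObj.finite (U : Type) [Finite U] : Finite (CompObj F G U) := by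
  let e : CompObj F G U → Σ π : SetPartition U, F.obj ↥π.1 × ∀ Q : ↥π.1, G.obj ↥Q.1 :=
    fun s => ⟨s.part, s.outer, s.inner⟩
  have (π : SetPartition U) : Finite (F.obj ↥π.1 × ∀ Q : ↥π.1, G.obj ↥Q.1) := inferInstance
  refine Finite.of_injective e ?_
  rintro ⟨p, o, i⟩ ⟨p', o', i'⟩ h
  simp only [e, Sigma.mk.injEq] at h
  obtain ⟨rfl, h⟩ := h
  simp only [heq_eq_eq, Prod.mk.injEq] at h
  rw [h.1, h.2]

theorem CompObj.map_refl {U : Type} [Finite U] (s : CompObj F G U) :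
    s.map (Equiv.refl U) = s := by
  obtain ⟨p, o, i⟩ := s
  have h1 : F.map (p.mapEquiv (Equiv.refl U)) o = o := by
    have : p.mapEquiv (Equiv.refl U) = Equiv.refl ↥p.1 := by
      ext1 Q
      exact Subtype.ext (Set.image_id Q.1)
    exact (congrArg (fun e => F.map e o) this).trans (F.map_refl o)
  have h2 : (fun P : ↥p.1 => G.map (restrictEquiv (Equiv.refl U) P.1) (i P)) = i := by
    funext P
    exact G.map_refl (i P)
  exact (congrArg (fun o' => CompObj.mk p o' _) h1).trans (congrArg (CompObj.mk p o) h2)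

theorem CompObj.map_trans {U V W : Type} [Finite U] [Finite V] [Finite W] (σ : U ≃ V) (τ : V ≃ W)
    (s : CompObj F G U) : s.map (σ.trans τ) = (s.map σ).map τ := by
  obtain ⟨p, o, i⟩ := s
  have h1 : F.map (p.mapEquiv (σ.trans τ)) o
      = F.map ((p.map σ).mapEquiv τ) (F.map (p.mapEquiv σ) o) := by
    have : p.mapEquiv (σ.trans τ) = (p.mapEquiv σ).trans ((p.map σ).mapEquiv τ) := by
      ext1 Q
      exact Subtype.ext (Set.image_comp τ σ Q.1)
    exact (congrArg (fun e => F.map e o) this).trans (F.map_trans _ _ o)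
  have h2 : (fun P : ↥((p.map σ).map τ).1 => G.map (restrictEquiv (σ.trans τ) P.1)
        (i ⟨σ ⁻¹' (τ ⁻¹' P.1), P.2⟩))
      = fun P : ↥((p.map σ).map τ).1 => G.map (restrictEquiv τ P.1) (G.map (restrictEquiv σ (τ ⁻¹' P.1))
        (i ⟨σ ⁻¹' (τ ⁻¹' P.1), P.2⟩)) := by
    funext P
    exact G.map_trans (restrictEquiv σ (τ ⁻¹' P.1)) (restrictEquiv τ P.1) _
  exact (congrArg (fun o' => CompObj.mk ((p.map σ).map τ) o' _) h1).trans
    (congrArg (CompObj.mk ((p.map σ).map τ) _) h2)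

theorem CompObj.weight_map {U V : Type} [Finite U] [Finite V] (σ : U ≃ V) (s : CompObj F G U) :
    (s.map σ).weight = s.weight := by
  unfold CompObj.weight
  congr 1
  · exact F.weight_map _ _
  · rw [← finprod_comp_equiv (s.part.mapEquiv σ).symm]
    exact finprod_congr fun P => G.weight_map _ _

variable (F G)

/-- The composition `F ∘ G`. (It is only used when `G[∅] = ∅`.) -/
def comp : WeightedSpecies.{max u v} where
  obj U _ := CompObj F G U
  finite_obj U _ := CompObj.finite U
  map σ s := s.map σ
  map_refl s := s.map_refl
  map_trans σ τ s := s.map_trans σ τ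
  weight s := s.weight
  weight_map σ s := s.weight_map σ

variable {F G}

/-- The `F' ∘ G`-structure on `U \ Q₀` that is left when the component `Q₀` is deleted: the atom
`Q₀` of the `F`-structure is relabelled to the placeholder `*`. -/
def CompObj.remove {U : Type} [Finite U] (s : CompObj F G U) (Q₀ : ↥s.part.1) :
    CompObj F.derived G ↥(Q₀.1ᶜ) where
  part := s.part.remove Q₀
  outer := F.map (s.part.removeEquiv Q₀) s.outer
  inner P := G.map (Equiv.Set.image Subtype.val P.1 Subtype.val_injective).symm
    (s.inner ⟨Subtype.val '' P.1, P.2⟩)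

/-- The unique order-preserving bijection from `A ⊆ [n]` to `[|A|]`. -/
def relabel {n : ℕ} (A : Set (Fin n)) : ↥A ≃ Fin (Nat.card ↥A) :=
  haveI := Fintype.ofFinite ↥A
  (monoEquivOfFin ↥A Nat.card_eq_fintype_card.symm).symm.toEquiv

/-- The remainder when the component `Q₀` is deleted from a composite structure on `[n]`,
relabelled in an order-preserving way. -/
def CompObj.remainder {n : ℕ} (s : CompObj F G (Fin n)) (Q₀ : ↥s.part.1) :
    (F.derived.comp G).Structures :=
  ⟨Nat.card ↥(Q₀.1ᶜ), (s.remove Q₀).map (relabel Q₀.1ᶜ)⟩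

/-- The components of maximal size. -/
def CompObj.largest {U : Type} [Finite U] (s : CompObj F G U) : Finset ↥s.part.1 :=
  (Set.toFinite {Q : ↥s.part.1 | ∀ Q' : ↥s.part.1, Nat.card ↥Q'.1 ≤ Nat.card ↥Q.1}).toFinset

theorem CompObj.largest_nonempty {U : Type} [Finite U] [Nonempty U] (s : CompObj F G U) :
    s.largest.Nonempty := by
  obtain ⟨Q, ⟨hQ, -⟩, -⟩ := s.part.2.2 (Classical.arbitrary U)
  have : Nonempty ↥s.part.1 := ⟨⟨Q, hQ⟩⟩
  obtain ⟨Q₀, h⟩ := Finite.exists_max (fun Q : ↥s.part.1 => Nat.card ↥Q.1)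
  exact ⟨Q₀, by simpa [CompObj.largest] using h⟩

end Comp

/-- The law of a structure sampled from `F[n]` with probability proportional to its weight,
for `n` with `[zⁿ]F(z) > 0`. -/
def gibbs (F : WeightedSpecies.{u}) (n : ℕ) (hn : 0 < PowerSeries.coeff n F.egs) :
    PMF (F.obj (Fin n)) :=
  PMF.normalize (fun s => (F.weight s : ℝ≥0∞))
    (by
      intro h
      rw [ENNReal.tsum_eq_zero] at h
      have h' : ∀ s : F.obj (Fin n), F.weight s = 0 := fun s => by exact_mod_cast h s
      simp [egs, h'] at hn)
    (by
      have := Fintype.ofFinite (F.obj (Fin n))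
      rw [tsum_fintype]
      exact ENNReal.sum_ne_top.2 fun _ _ => ENNReal.coe_ne_top)

/-- The law of the remainder `Rₙ`: sample `Sₙ` from `(F ∘ G)[n]` with probability proportional to
its weight, and delete a uniformly chosen component of maximal size. -/
def remainderLaw (F : WeightedSpecies.{u}) (G : WeightedSpecies.{v}) (n : ℕ) (hpos : 0 < n)
    (hn : 0 < PowerSeries.coeff n (F.comp G).egs) : PMF (F.derived.comp G).Structures :=
  haveI : Nonempty (Fin n) := ⟨⟨0, hpos⟩⟩
  ((F.comp G).gibbs n hn).bind fun s : CompObj F G (Fin n) =>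
    (PMF.uniformOfFinset s.largest s.largest_nonempty).map fun Q₀ => s.remainder Q₀

/-- The Boltzmann weight `ω(s) y^|s| / |s|!`. -/
def boltzmannWeight (F : WeightedSpecies.{u}) (y : ℝ≥0) (s : F.Structures) : ℝ≥0∞ :=
  ((F.weight s.2 * y ^ s.1 / (s.1 ! : ℝ≥0) : ℝ≥0) : ℝ≥0∞)

/-- `0 < F(y) < ∞`, where `F(y) = ∑ ω(s) y^|s| / |s|!`, the sum over all structures `s`. -/
def IsBoltzmannParameter (F : WeightedSpecies.{u}) (y : ℝ≥0) : Prop :=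
  (∑' s, F.boltzmannWeight y s) ≠ 0 ∧ (∑' s, F.boltzmannWeight y s) ≠ ∞

/-- The Boltzmann distribution `P(s) = F(y)⁻¹ ω(s) y^|s| / |s|!`. -/
def boltzmann (F : WeightedSpecies.{u}) (y : ℝ≥0) (h : F.IsBoltzmannParameter y) :
    PMF F.Structures :=
  PMF.normalize (F.boltzmannWeight y) h.1 h.2

end WeightedSpecies

/-- The radius of convergence of a real power series. -/
def radiusOfConvergence (g : PowerSeries ℝ) : ℝ≥0∞ :=
  (FormalMultilinearSeries.ofScalars ℝ fun n => PowerSeries.coeff n g).radius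

/-- The value `∑ gₙ xⁿ` of a power series (only used where the series converges). -/
def seriesValue (g : PowerSeries ℝ) (x : ℝ) : ℝ := ∑' n, PowerSeries.coeff n g * x ^ n

/-- The power series `g` belongs to the class `𝒮_d` of subexponential series with span `d`, and its
radius of convergence is `ρ`. -/
structure IsSubexponential (d : ℕ) (g : PowerSeries ℝ) (ρ : ℝ≥0) : Prop where
  one_le_span : 1 ≤ d
  coeff_nonneg : ∀ n, 0 ≤ PowerSeries.coeff n g
  radius_pos : 0 < ρ
  radius_eq : radiusOfConvergence g = ρ
  coeff_eq_zero : ∀ n, ¬ d ∣ n → PowerSeries.coeff n g = 0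
  tendsto_ratio : Filter.Tendsto
    (fun k : ℕ => PowerSeries.coeff (d * k) g / PowerSeries.coeff (d * k + d) g)
    Filter.atTop (nhds ((ρ : ℝ) ^ d))
  summable : Summable fun n => PowerSeries.coeff n g * (ρ : ℝ) ^ n
  tendsto_conv : Filter.Tendsto
    (fun k : ℕ => (∑ p ∈ Finset.HasAntidiagonal.antidiagonal (d * k),
      PowerSeries.coeff p.1 g * PowerSeries.coeff p.2 g) / PowerSeries.coeff (d * k) g)
    Filter.atTop (nhds (2 * seriesValue g ρ))

/-- The total variation distance `sup_E |p(E) - q(E)|` of two discrete distributions. -/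
def totalVariationDist {S : Type u} (p q : PMF S) : ℝ :=
  ⨆ E : Set S, |(p.toOuterMeasure E).toReal - (q.toOuterMeasure E).toReal|

end

/-!
Marking a component of an `F ∘ G`-structure splits it into an `F' ∘ G`-structure (the remainder)
and a `G`-structure, so marked structures are counted by `F'(G(z)) G(z)`. Iterating this identity on
the number of components gives the series `F(G(z))` for `F ∘ G`.

After rescaling, the coefficients `a` of `G` form a subexponential sequence with sum `A = G(ρ)`:
the `k`-th convolution power of `a` is asymptotic to `k Aᵏ⁻¹ aₙ`, and Kesten's bound dominates it by
a multiple of `k A'ᵏ⁻¹ aₙ` for any `A' > A`. As `F` converges beyond `A`, dominated convergence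
gives `[zⁿ] F(G(z)) ~ F'(G(ρ)) [zⁿ] G(z)`.

A component that leaves a remainder of size less than `n / 2` is the unique largest one. Hence, for
a fixed `R` and large `n`, the probability of `Rₙ = R` is `μ(R) / |R|!` times the ratio of
`[zⁿ⁻|R|] G(z)` and `[zⁿ] F(G(z))`, which tends to the Boltzmann probability of `R`. By Scheffé's
lemma this pointwise convergence holds in total variation.
-/

open Filter Topology PowerSeries

/-! ### Power series with non-negative coefficients -/

section NonnegativeSeries

variable {a b c e f g : PowerSeries ℝ} {y A B C D Z : ℝ}

theorem coeff_mul_nonneg (hb : ∀ n, 0 ≤ coeff n b) (hc : ∀ n, 0 ≤ coeff n c) (n : ℕ) :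
    0 ≤ coeff n (b * c) := by
  rw [coeff_mul]
  exact Finset.sum_nonneg fun p _ => mul_nonneg (hb p.1) (hc p.2)

theorem coeff_pow_nonneg (hb : ∀ n, 0 ≤ coeff n b) (k n : ℕ) : 0 ≤ coeff n (b ^ k) := by
  induction k generalizing n with
  | zero =>
    rw [pow_zero, coeff_one]
    split_ifs <;> simp
  | succ k ih =>
    rw [pow_succ]
    exact coeff_mul_nonneg ih hb n

theorem hasSum_coeff_mul (hb : HasSum (fun n => coeff n b) B) (hc : HasSum (fun n => coeff n c) C) :
    HasSum (fun n => coeff n (b * c)) (B * C) := by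
  simp only [coeff_mul]
  rw [← hb.tsum_eq, ← hc.tsum_eq, tsum_mul_tsum_eq_tsum_sum_antidiagonal_of_summable_norm
    hb.summable.norm hc.summable.norm]
  exact (summable_norm_sum_mul_antidiagonal_of_summable_norm
    hb.summable.norm hc.summable.norm).of_norm.hasSum

theorem hasSum_coeff_pow (hb : HasSum (fun n => coeff n b) B) (k : ℕ) :
    HasSum (fun n => coeff n (b ^ k)) (B ^ k) := by
  induction k with
  | zero =>
    simpa using hasSum_single (f := fun n => coeff n (1 : PowerSeries ℝ)) 0
      fun n hn => by simp [coeff_one, hn]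
  | succ k ih => simpa only [pow_succ] using hasSum_coeff_mul ih hb

theorem hasSum_coeff_pow_mul_pow (hg : HasSum (fun n => coeff n g * y ^ n) A) (k : ℕ) :
    HasSum (fun n => coeff n (g ^ k) * y ^ n) (A ^ k) := by
  have hrescale (s : PowerSeries ℝ) (n : ℕ) : coeff n s * y ^ n = coeff n (rescale y s) := by
    rw [coeff_rescale, mul_comm]
  simp only [hrescale, map_pow] at hg ⊢
  exact hasSum_coeff_pow hg k

theorem hasSum_coeff_subst (hg : HasSubst g) (f : PowerSeries ℝ) (n : ℕ) :
    HasSum (fun k => coeff k f * coeff n (g ^ k)) (coeff n (f.subst g)) := by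
  have hfinite := coeff_subst_finite' hg f n
  rw [coeff_subst' hg, ← tsum_eq_finsum (L := .unconditional ℕ) hfinite]
  exact (summable_of_hasFiniteSupport hfinite).hasSum

theorem hasSum_coeff_subst_mul_pow (hg : HasSubst g) (hf₀ : ∀ n, 0 ≤ coeff n f)
    (hg₀ : ∀ n, 0 ≤ coeff n g) (hy : 0 ≤ y) (hA : HasSum (fun n => coeff n g * y ^ n) A)
    (hZ : HasSum (fun k => coeff k f * A ^ k) Z) :
    HasSum (fun n => coeff n (f.subst g) * y ^ n) Z := by
  let term (p : ℕ × ℕ) : ℝ := coeff p.1 f * (coeff p.2 (g ^ p.1) * y ^ p.2)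
  have hrow (k : ℕ) : HasSum (fun n => term (k, n)) (coeff k f * A ^ k) :=
    (hasSum_coeff_pow_mul_pow hA k).mul_left _
  have hcolumn (n : ℕ) : HasSum (fun k => term (k, n)) (coeff n (f.subst g) * y ^ n) := by
    simpa only [term, mul_assoc] using (hasSum_coeff_subst hg f n).mul_right (y ^ n)
  have hterm : Summable term := by
    refine (summable_prod_of_nonneg fun p => ?_).2 ⟨fun k => (hrow k).summable, ?_⟩
    · exact mul_nonneg (hf₀ _) (mul_nonneg (coeff_pow_nonneg hg₀ _ _) (pow_nonneg hy _))
    · simpa only [(hrow _).tsum_eq] using hZ.summable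
  rw [hZ.unique (hterm.hasSum.prod_fiberwise hrow)]
  exact ((Equiv.prodComm ℕ ℕ).hasSum_iff.2 hterm.hasSum).prod_fiberwise hcolumn

theorem hasSum_coeff_mul_natCast_mul_pow_iff :
    HasSum (fun k => coeff k f * (k * y ^ (k - 1))) Z ↔
      HasSum (fun k => coeff k (d⁄dX ℝ f) * y ^ k) Z := by
  simp [← hasSum_nat_add_iff' (f := fun k => coeff k f * (k * y ^ (k - 1))) 1, coeff_derivative,
    mul_assoc]

theorem summable_coeff_derivative_mul_pow (hy : 0 ≤ y)
    (h : ENNReal.ofReal y < radiusOfConvergence f) :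
    Summable fun k => coeff k (d⁄dX ℝ f) * y ^ k := by
  obtain ⟨r, hyr, hr⟩ := ENNReal.lt_iff_exists_nnreal_btwn.1 h
  replace hyr : y < r := (ENNReal.ofReal_lt_coe_iff hy).1 hyr
  obtain ⟨C, -, hC⟩ := FormalMultilinearSeries.norm_mul_pow_le_of_lt_radius _ hr
  simp only [FormalMultilinearSeries.ofScalars_norm] at hC
  have hr₀ : (0 : ℝ) < r := hy.trans_lt hyr
  have hratio : ‖y / r‖ < 1 := by rwa [Real.norm_of_nonneg (by positivity), div_lt_one hr₀]
  refine .of_norm_bounded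
    ((summable_choose_mul_geometric_of_norm_lt_one 1 hratio).mul_left (C / r)) fun k => ?_
  calc ‖coeff k (d⁄dX ℝ f) * y ^ k‖
      = |coeff (k + 1) f| * r ^ (k + 1) / r * ((k + 1) * (y / r) ^ k) := by
        rw [coeff_derivative, norm_mul, norm_mul, Real.norm_of_nonneg (by positivity : 0 ≤ y ^ k),
          Real.norm_of_nonneg (by positivity : (0 : ℝ) ≤ k + 1), Real.norm_eq_abs, div_pow,
          pow_succ]
        field_simp
    _ ≤ C / r * ((k + 1) * (y / r) ^ k) := by
        gcongr
        exact hC (k + 1)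
    _ = C / r * ((k + 1).choose 1 * (y / r) ^ k) := by rw [Nat.choose_one_right, Nat.cast_succ]

theorem seriesValue_derivative_pos (hf₀ : ∀ n, 0 ≤ coeff n f) (hf : ∃ k, 1 ≤ k ∧ 0 < coeff k f)
    (hy : 0 < y) (h : ENNReal.ofReal y < radiusOfConvergence f) :
    0 < seriesValue (d⁄dX ℝ f) y := by
  obtain ⟨k, hk, hfk⟩ := hf
  obtain ⟨j, rfl⟩ := Nat.exists_eq_add_of_le' hk
  refine (summable_coeff_derivative_mul_pow hy.le h).tsum_pos (fun n => ?_) j ?_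
  · rw [coeff_derivative]
    exact mul_nonneg (mul_nonneg (hf₀ _) (by positivity)) (by positivity)
  · rw [coeff_derivative]
    positivity

theorem abs_coeff_mul_le (hb : ∀ n, 0 ≤ coeff n b) (he : ∀ n, |coeff n e| ≤ D * coeff n a)
    (n : ℕ) : |coeff n (e * b)| ≤ D * coeff n (a * b) := by
  rw [coeff_mul, coeff_mul, Finset.mul_sum]
  refine (Finset.abs_sum_le_sum_abs _ _).trans (Finset.sum_le_sum fun p _ => ?_)
  rw [abs_mul, abs_of_nonneg (hb p.2), ← mul_assoc]
  exact mul_le_mul_of_nonneg_right (he _) (hb _)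

theorem coeff_sub_trunc (b : PowerSeries ℝ) (N n : ℕ) :
    coeff n (b - (trunc N b : PowerSeries ℝ)) = if n < N then 0 else coeff n b := by
  rw [map_sub, Polynomial.coeff_coe, coeff_trunc]
  split_ifs <;> simp

end NonnegativeSeries

/-! ### Subexponential sequences -/

/-- A summable sequence of non-negative numbers with sum `A` that is subexponential in the sense of
Chover, Ney and Wainger, encoded as the coefficients of a power series so that convolution is
multiplication. These are the series of class `𝒮₁` with radius of convergence `1`. -/
structure IsSubexponentialSeq (a : PowerSeries ℝ) (A : ℝ) : Prop where
  nonneg : ∀ n, 0 ≤ coeff n a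
  hasSum : HasSum (fun n => coeff n a) A
  tendsto_ratio : Tendsto (fun n => coeff n a / coeff (n + 1) a) atTop (𝓝 1)
  tendsto_conv : Tendsto (fun n => coeff n (a * a) / coeff n a) atTop (𝓝 (2 * A))

namespace IsSubexponentialSeq

variable {a b e : PowerSeries ℝ} {A A' B E β : ℝ}

theorem eventually_pos (h : IsSubexponentialSeq a A) : ∀ᶠ n in atTop, 0 < coeff n a := by
  filter_upwards [h.tendsto_ratio.eventually (lt_mem_nhds zero_lt_one)] with n hn
  refine (h.nonneg n).lt_of_ne' fun h₀ => ?_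
  simp [h₀] at hn

theorem sum_pos (h : IsSubexponentialSeq a A) : 0 < A := by
  obtain ⟨n, hn⟩ := h.eventually_pos.exists
  exact hn.trans_le (le_hasSum h.hasSum n fun i _ => h.nonneg i)

theorem tendsto_shift (h : IsSubexponentialSeq a A) (j : ℕ) :
    Tendsto (fun n => coeff (n - j) a / coeff n a) atTop (𝓝 1) := by
  rw [← tendsto_add_atTop_iff_nat j]
  simp only [Nat.add_sub_cancel]
  induction j with
  | zero =>
    refine tendsto_const_nhds.congr' ?_
    filter_upwards [h.eventually_pos] with n hn
    exact (div_self hn.ne').symm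
  | succ j ih =>
    have hratio := ih.mul ((tendsto_add_atTop_iff_nat j).2 h.tendsto_ratio)
    rw [mul_one] at hratio
    refine hratio.congr' ?_
    filter_upwards [(tendsto_add_atTop_nat j).eventually h.eventually_pos] with n hn
    rw [div_mul_div_cancel₀ hn.ne', add_assoc]

theorem tendsto_trunc_mul (h : IsSubexponentialSeq a A) (e : PowerSeries ℝ) (M : ℕ) :
    Tendsto (fun n => coeff n ((trunc M e : PowerSeries ℝ) * a) / coeff n a) atTop
      (𝓝 (∑ i ∈ Finset.range M, coeff i e)) := by
  have hlim : Tendsto (fun n => ∑ i ∈ Finset.range M, coeff i e * (coeff (n - i) a / coeff n a))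
      atTop (𝓝 (∑ i ∈ Finset.range M, coeff i e)) := by
    simpa only [mul_one] using
      tendsto_finsetSum (Finset.range M) fun i _ => (h.tendsto_shift i).const_mul (coeff i e)
  refine hlim.congr' ?_
  filter_upwards [eventually_ge_atTop M] with n hn
  rw [coeff_mul, Finset.Nat.sum_antidiagonal_eq_sum_range_succ
    (fun i j => coeff i (trunc M e : PowerSeries ℝ) * coeff j a), Finset.sum_div]
  refine Finset.sum_subset_zero_on_sdiff (Finset.range_mono (by omega)) (fun i hi => ?_)
    fun i hi => ?_
  · rw [Polynomial.coeff_coe, coeff_trunc, if_neg (by simp at hi; omega), zero_mul, zero_div]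
  · rw [Polynomial.coeff_coe, coeff_trunc, if_pos (Finset.mem_range.1 hi), mul_div_assoc]

/-- The terms `eᵢ aₙ₋ᵢ` with `i ≥ M` contribute at most `ε (a * a)ₙ`, and `(a * a)ₙ = O(aₙ)`. -/
theorem tendstoUniformly_trunc_mul (h : IsSubexponentialSeq a A)
    (he : (fun n => coeff n e) =o[atTop] fun n => coeff n a) :
    TendstoUniformlyOnFilter
      (fun M n => coeff n ((trunc M e : PowerSeries ℝ) * a) / coeff n a)
      (fun n => coeff n (e * a) / coeff n a) atTop atTop := by
  rw [Metric.tendstoUniformlyOnFilter_iff]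
  intro ε hε
  have hA := h.sum_pos
  set δ := ε / (2 * A + 1)
  have hδ : 0 < δ := by positivity
  obtain ⟨M₀, hM₀⟩ := eventually_atTop.1 (he.bound hδ)
  have hconv := h.tendsto_conv.eventually (gt_mem_nhds (lt_add_one (2 * A)))
  filter_upwards [(eventually_ge_atTop M₀).prod_mk (h.eventually_pos.and hconv)]
    with ⟨M, n⟩ ⟨hM, hn, hconv⟩
  have htail (i : ℕ) : |coeff i (e - (trunc M e : PowerSeries ℝ))| ≤ δ * coeff i a := by
    rw [coeff_sub_trunc]
    split_ifs with hi
    · simpa using mul_nonneg hδ.le (h.nonneg i)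
    · simpa [abs_of_nonneg (h.nonneg i)] using hM₀ i (by omega)
  calc dist (coeff n (e * a) / coeff n a) (coeff n ((trunc M e : PowerSeries ℝ) * a) / coeff n a)
      = |coeff n ((e - (trunc M e : PowerSeries ℝ)) * a)| / coeff n a := by
        rw [Real.dist_eq, ← sub_div, ← map_sub, ← sub_mul, abs_div, abs_of_pos hn]
    _ ≤ δ * coeff n (a * a) / coeff n a := by
        gcongr
        exact abs_coeff_mul_le h.nonneg htail n
    _ = δ * (coeff n (a * a) / coeff n a) := mul_div_assoc _ _ _
    _ < δ * (2 * A + 1) := by gcongr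
    _ = ε := div_mul_cancel₀ _ (by positivity)

theorem tendsto_mul_of_isLittleO (h : IsSubexponentialSeq a A)
    (hE : HasSum (fun n => coeff n e) E) (he : (fun n => coeff n e) =o[atTop] fun n => coeff n a) :
    Tendsto (fun n => coeff n (e * a) / coeff n a) atTop (𝓝 E) :=
  (h.tendstoUniformly_trunc_mul he).tendsto_of_eventually_tendsto
    (.of_forall fun M => h.tendsto_trunc_mul e M) hE.tendsto_sum_nat

theorem tendsto_mul (h : IsSubexponentialSeq a A) (hB : HasSum (fun n => coeff n b) B)
    (hb : Tendsto (fun n => coeff n b / coeff n a) atTop (𝓝 β)) :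
    Tendsto (fun n => coeff n (b * a) / coeff n a) atTop (𝓝 (B + β * A)) := by
  have hsum : HasSum (fun n => coeff n (b - C β * a)) (B - β * A) := by
    simpa using hB.sub (h.hasSum.mul_left β)
  have hlittle : (fun n => coeff n (b - C β * a)) =o[atTop] fun n => coeff n a := by
    refine (Asymptotics.isLittleO_iff_tendsto' ?_).2 ?_
    · filter_upwards [h.eventually_pos] with n hn h₀
      exact absurd h₀ hn.ne'
    · rw [← sub_self β]
      refine (hb.sub_const β).congr' ?_
      filter_upwards [h.eventually_pos] with n hn
      rw [map_sub, coeff_C_mul, sub_div, mul_div_cancel_right₀ _ hn.ne']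
  have hlim := (h.tendsto_mul_of_isLittleO hsum hlittle).add (h.tendsto_conv.const_mul β)
  rw [show B - β * A + β * (2 * A) = B + β * A by ring] at hlim
  refine hlim.congr fun n => ?_
  rw [← mul_div_assoc, ← add_div, ← coeff_C_mul, ← map_add]
  ring_nf

theorem tendsto_pow (h : IsSubexponentialSeq a A) (k : ℕ) :
    Tendsto (fun n => coeff n (a ^ k) / coeff n a) atTop (𝓝 (k * A ^ (k - 1))) := by
  induction k with
  | zero =>
    rw [Nat.cast_zero, zero_mul]
    refine tendsto_const_nhds.congr' ?_
    filter_upwards [eventually_ne_atTop 0] with n hn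
    simp [coeff_one, hn]
  | succ k ih =>
    have hmul := h.tendsto_mul (hasSum_coeff_pow h.hasSum k) ih
    have hlim : A ^ k + k * A ^ (k - 1) * A = ((k + 1 : ℕ) : ℝ) * A ^ (k + 1 - 1) := by
      rcases k with _ | k
      · simp
      · simp only [Nat.add_sub_cancel]
        push_cast
        ring
    simpa only [pow_succ, hlim] using hmul

theorem exists_tail_mul_le (h : IsSubexponentialSeq a A) (hA' : A < A') :
    ∃ N > 0, (∀ n ≥ N, 0 < coeff n a) ∧ ∀ᶠ n in atTop,
      coeff n ((a - (trunc N a : PowerSeries ℝ)) * a) ≤ A' * coeff n a ∧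
        ∀ i < N, coeff (n - i) a ≤ 2 * coeff n a := by
  have hpartial := h.hasSum.tendsto_sum_nat.eventually (lt_mem_nhds (sub_lt_self A (sub_pos.2 hA')))
  obtain ⟨N, hN, hpos, hpartial⟩ := ((eventually_gt_atTop 0).and
    ((eventually_forall_ge_atTop.2 h.eventually_pos).and hpartial)).exists
  have htail : Tendsto (fun n => coeff n ((a - (trunc N a : PowerSeries ℝ)) * a) / coeff n a) atTop
      (𝓝 (2 * A - ∑ i ∈ Finset.range N, coeff i a)) := by
    refine (h.tendsto_conv.sub (h.tendsto_trunc_mul a N)).congr fun n => ?_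
    rw [sub_mul, map_sub, sub_div]
  have hshift : ∀ᶠ n in atTop, ∀ i < N, coeff (n - i) a / coeff n a < 2 :=
    (eventually_all_finite (Set.finite_Iio N)).2
      fun i _ => (h.tendsto_shift i).eventually (gt_mem_nhds one_lt_two)
  refine ⟨N, hN, hpos, ?_⟩
  filter_upwards [eventually_ge_atTop N, htail.eventually (gt_mem_nhds (by linarith : _ < A')),
    hshift] with n hn htail hshift
  exact ⟨((div_lt_iff₀ (hpos n hn)).1 htail).le,
    fun i hi => ((div_lt_iff₀ (hpos n hn)).1 (hshift i hi)).le⟩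

end IsSubexponentialSeq

theorem coeff_trunc_mul_le {a b : PowerSeries ℝ} {B c : ℝ} {N n : ℕ} (hb : ∀ i, 0 ≤ coeff i b)
    (hB : HasSum (fun i => coeff i b) B) (hc : 0 ≤ c) (ha : ∀ i < N, coeff (n - i) a ≤ c) :
    coeff n ((trunc N b : PowerSeries ℝ) * a) ≤ B * c := by
  rw [coeff_mul, Finset.Nat.sum_antidiagonal_eq_sum_range_succ
    (fun i j => coeff i (trunc N b : PowerSeries ℝ) * coeff j a)]
  calc ∑ i ∈ Finset.range n.succ, coeff i (trunc N b : PowerSeries ℝ) * coeff (n - i) a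
      ≤ ∑ i ∈ Finset.range n.succ, coeff i b * c := by
        refine Finset.sum_le_sum fun i _ => ?_
        rw [Polynomial.coeff_coe, coeff_trunc]
        split_ifs with hi
        · exact mul_le_mul_of_nonneg_left (ha i hi) (hb i)
        · simpa using mul_nonneg (hb i) hc
    _ = (∑ i ∈ Finset.range n.succ, coeff i b) * c := (Finset.sum_mul _ _ _).symm
    _ ≤ B * c := mul_le_mul_of_nonneg_right (sum_le_hasSum _ (fun i _ => hb i) hB) hc

theorem coeff_sub_trunc_mul_le {a b c : PowerSeries ℝ} {D : ℝ} {N : ℕ} (hc : ∀ n, 0 ≤ coeff n c)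
    (hb : ∀ n ≥ N, coeff n b ≤ D * coeff n a) (n : ℕ) :
    coeff n ((b - (trunc N b : PowerSeries ℝ)) * c)
      ≤ D * coeff n ((a - (trunc N a : PowerSeries ℝ)) * c) := by
  rw [coeff_mul, coeff_mul, Finset.mul_sum]
  refine Finset.sum_le_sum fun p _ => ?_
  rw [← mul_assoc, coeff_sub_trunc, coeff_sub_trunc]
  refine mul_le_mul_of_nonneg_right ?_ (hc _)
  split_ifs with hp
  · simp
  · exact hb p.1 (not_lt.1 hp)

namespace IsSubexponentialSeq

variable {a : PowerSeries ℝ} {A A' : ℝ}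

/-- The constant `K` is uniform in `b`, so that the bound can be iterated along `b = aᵏ`. -/
theorem exists_coeff_mul_le (h : IsSubexponentialSeq a A) (hA' : A < A') :
    ∃ N > 0, ∃ K, 0 ≤ K ∧ (∀ n ≥ N, 0 < coeff n a) ∧ ∀ (b : PowerSeries ℝ) (B D : ℝ),
      (∀ n, 0 ≤ coeff n b) → HasSum (fun n => coeff n b) B → 0 ≤ D →
      (∀ n ≥ N, coeff n b ≤ D * coeff n a) →
      ∀ n ≥ N, coeff n (b * a) ≤ (D * A' + K * B) * coeff n a := by
  obtain ⟨N, hN, hpos, htail⟩ := h.exists_tail_mul_le hA'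
  obtain ⟨M, htail⟩ := eventually_atTop.1 htail
  obtain ⟨L, hL⟩ := ((Set.finite_Iio M).image fun n => (coeff n a)⁻¹).bddAbove
  have hA := h.sum_pos
  refine ⟨N, hN, max 2 (L * A), by positivity, hpos, fun b B D hb hB hD hbD n hn => ?_⟩
  have hB₀ : 0 ≤ B := hB.nonneg hb
  have ha := hpos n hn
  rcases lt_or_ge n M with hnM | hnM
  · have hL₁ : 1 ≤ L * coeff n a := by
      rw [← inv_mul_cancel₀ ha.ne']
      exact mul_le_mul_of_nonneg_right (hL ⟨n, hnM, rfl⟩) ha.le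
    calc coeff n (b * a)
        ≤ B * A := le_hasSum (hasSum_coeff_mul hB h.hasSum) n
          fun i _ => coeff_mul_nonneg hb h.nonneg i
      _ ≤ B * A * (L * coeff n a) := le_mul_of_one_le_right (by positivity) hL₁
      _ = (D * 0 + L * A * B) * coeff n a := by ring
      _ ≤ (D * A' + max 2 (L * A) * B) * coeff n a := by
        gcongr
        · exact (hA.trans hA').le
        · exact le_max_right _ _
  · obtain ⟨htail, hshift⟩ := htail n hnM
    calc coeff n (b * a)
        = coeff n ((b - (trunc N b : PowerSeries ℝ)) * a)
          + coeff n ((trunc N b : PowerSeries ℝ) * a) := by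
            rw [← map_add, ← add_mul, sub_add_cancel]
      _ ≤ D * coeff n ((a - (trunc N a : PowerSeries ℝ)) * a) + B * (2 * coeff n a) :=
        add_le_add (coeff_sub_trunc_mul_le h.nonneg hbD n)
          (coeff_trunc_mul_le hb hB (by positivity) hshift)
      _ ≤ D * (A' * coeff n a) + B * (2 * coeff n a) := by gcongr
      _ = (D * A' + 2 * B) * coeff n a := by ring
      _ ≤ (D * A' + max 2 (L * A) * B) * coeff n a := by gcongr; exact le_max_left _ _

theorem exists_coeff_pow_le (h : IsSubexponentialSeq a A) (hA' : A < A') :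
    ∃ N K, (∀ n ≥ N, 0 < coeff n a) ∧
      ∀ (k : ℕ), ∀ n ≥ N, coeff n (a ^ k) ≤ K * (k * A' ^ (k - 1)) * coeff n a := by
  obtain ⟨N, hN, K, hK, hpos, hmul⟩ := h.exists_coeff_mul_le hA'
  have hA'₀ : 0 < A' := h.sum_pos.trans hA'
  refine ⟨N, K, hpos, fun k => ?_⟩
  induction k with
  | zero =>
    intro n hn
    simp [coeff_one, (hN.trans_le hn).ne']
  | succ k ih =>
    intro n hn
    have hstep : (k : ℝ) * A' ^ (k - 1) * A' = k * A' ^ k := by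
      rcases k with _ | k
      · simp
      · rw [Nat.add_sub_cancel, pow_succ]; ring
    calc coeff n (a ^ (k + 1))
        ≤ (K * (k * A' ^ (k - 1)) * A' + K * A ^ k) * coeff n a := by
          rw [pow_succ]
          exact hmul _ _ _ (coeff_pow_nonneg h.nonneg k) (hasSum_coeff_pow h.hasSum k)
            (by positivity) ih n hn
      _ ≤ (K * (k * A' ^ (k - 1)) * A' + K * A' ^ k) * coeff n a := by
          have hA := h.sum_pos
          have ha := hpos n hn
          gcongr
      _ = K * ((k + 1 : ℕ) * A' ^ (k + 1 - 1)) * coeff n a := by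
          rw [mul_assoc, hstep, Nat.add_sub_cancel, Nat.cast_succ]; ring

theorem tendsto_tsum_mul_pow (h : IsSubexponentialSeq a A) (hA' : A < A') {f : ℕ → ℝ}
    (hf : Summable fun k => f k * (k * A' ^ (k - 1))) :
    Tendsto (fun n => (∑' k, f k * coeff n (a ^ k)) / coeff n a) atTop
      (𝓝 (∑' k : ℕ, f k * (k * A ^ (k - 1)))) := by
  obtain ⟨N, K, hpos, hpow⟩ := h.exists_coeff_pow_le hA'
  have hA'₀ : 0 < A' := h.sum_pos.trans hA'
  simp only [← tsum_div_const, mul_div_assoc]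
  refine tendsto_tsum_of_dominated_convergence (hf.norm.mul_left K)
    (fun k => (h.tendsto_pow k).const_mul (f k)) ?_
  filter_upwards [eventually_ge_atTop N] with n hn k
  have hratio : 0 ≤ coeff n (a ^ k) / coeff n a :=
    div_nonneg (coeff_pow_nonneg h.nonneg k n) (h.nonneg n)
  calc ‖f k * (coeff n (a ^ k) / coeff n a)‖
      = ‖f k‖ * (coeff n (a ^ k) / coeff n a) := by rw [norm_mul, Real.norm_of_nonneg hratio]
    _ ≤ ‖f k‖ * (K * (k * A' ^ (k - 1))) := by
      gcongr
      exact (div_le_iff₀ (hpos n hn)).2 (hpow k n hn)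
    _ = K * ‖f k * (k * A' ^ (k - 1))‖ := by
      rw [norm_mul, Real.norm_of_nonneg (by positivity : 0 ≤ (k : ℝ) * A' ^ (k - 1))]
      ring

end IsSubexponentialSeq

/-- The filter of limits as `n → ∞` along the multiples of `d`. -/
def multiplesAtTop (d : ℕ) : Filter ℕ := atTop ⊓ 𝓟 {n | d ∣ n}

theorem multiplesAtTop_eq_map {d : ℕ} (hd : d ≠ 0) : multiplesAtTop d = map (d * ·) atTop := by
  ext s
  simp only [multiplesAtTop, mem_inf_principal, mem_map, mem_atTop_sets]
  constructor
  · rintro ⟨N, hN⟩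
    exact ⟨N, fun k hk => hN _ (hk.trans (Nat.le_mul_of_pos_left k (by omega))) ⟨k, rfl⟩⟩
  · rintro ⟨N, hN⟩
    refine ⟨d * N, ?_⟩
    rintro _ hn ⟨k, rfl⟩
    exact hN k (Nat.le_of_mul_le_mul_left hn (by omega))

namespace IsSubexponential

variable {d : ℕ} {f g : PowerSeries ℝ} {ρ : ℝ≥0}

/-- The series `∑ₖ g_{dk} ρ^{dk} zᵏ`, which reduces the class `𝒮_d` to the case `d = ρ = 1`. -/
noncomputable def spanSeries (d : ℕ) (g : PowerSeries ℝ) (ρ : ℝ≥0) : PowerSeries ℝ :=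
  PowerSeries.mk fun k => coeff (d * k) g * (ρ : ℝ) ^ (d * k)

theorem span_ne_zero (h : IsSubexponential d g ρ) : d ≠ 0 :=
  Nat.one_le_iff_ne_zero.1 h.one_le_span

theorem radius_pow_pos (h : IsSubexponential d g ρ) (n : ℕ) : 0 < (ρ : ℝ) ^ n :=
  pow_pos (NNReal.coe_pos.2 h.radius_pos) n

theorem rescale_eq_expand (h : IsSubexponential d g ρ) :
    rescale (ρ : ℝ) g = expand d h.span_ne_zero (spanSeries d g ρ) := by
  ext n
  rw [coeff_rescale]
  by_cases hn : d ∣ n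
  · obtain ⟨k, rfl⟩ := hn
    rw [coeff_expand_mul, spanSeries, coeff_mk, mul_comm]
  · rw [h.coeff_eq_zero n hn, coeff_expand_of_not_dvd _ _ _ hn, mul_zero]

theorem coeff_pow_mul_pow (h : IsSubexponential d g ρ) (j k : ℕ) :
    coeff (d * k) (g ^ j) * (ρ : ℝ) ^ (d * k) = coeff k (spanSeries d g ρ ^ j) := by
  have hpow := congrArg (fun s => coeff (d * k) (s ^ j)) h.rescale_eq_expand
  simp only [← map_pow, coeff_rescale, coeff_expand_mul] at hpow
  rw [mul_comm, hpow]

theorem coeff_pow_eq_zero (h : IsSubexponential d g ρ) (j : ℕ) {n : ℕ} (hn : ¬ d ∣ n) :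
    coeff n (g ^ j) = 0 := by
  have hpow := congrArg (fun s => coeff n (s ^ j)) h.rescale_eq_expand
  simp only [← map_pow, coeff_rescale, coeff_expand_of_not_dvd _ _ _ hn] at hpow
  exact (mul_eq_zero.1 hpow).resolve_left (h.radius_pow_pos n).ne'

theorem coeff_subst_eq_zero (h : IsSubexponential d g ρ) (hg : HasSubst g) (f : PowerSeries ℝ)
    {n : ℕ} (hn : ¬ d ∣ n) : coeff n (f.subst g) = 0 := by
  refine (hasSum_coeff_subst hg f n).unique ?_
  simpa only [h.coeff_pow_eq_zero _ hn, mul_zero] using hasSum_zero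

theorem hasSum (h : IsSubexponential d g ρ) :
    HasSum (fun n => coeff n g * (ρ : ℝ) ^ n) (seriesValue g ρ) :=
  h.summable.hasSum

theorem isSubexponentialSeq_spanSeries (h : IsSubexponential d g ρ) :
    IsSubexponentialSeq (spanSeries d g ρ) (seriesValue g ρ) where
  nonneg n := by
    rw [spanSeries, coeff_mk]
    exact mul_nonneg (h.coeff_nonneg _) (by positivity)
  hasSum := by
    have hinj : Function.Injective fun k : ℕ => d * k := fun _ _ => mul_left_cancel₀ h.span_ne_zero
    have hsupport : ∀ n ∉ Set.range fun k : ℕ => d * k, coeff n g * (ρ : ℝ) ^ n = 0 := by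
      intro n hn
      rw [h.coeff_eq_zero n fun ⟨k, hk⟩ => hn ⟨k, hk.symm⟩, zero_mul]
    simpa [spanSeries, Function.comp_def] using (hinj.hasSum_iff hsupport).2 h.hasSum
  tendsto_ratio := by
    rw [← div_self (h.radius_pow_pos d).ne']
    refine (h.tendsto_ratio.div_const _).congr fun k => ?_
    have hd := h.radius_pow_pos d
    have hk := h.radius_pow_pos (d * k)
    rw [spanSeries, coeff_mk, coeff_mk, mul_add, mul_one, pow_add]
    field_simp
  tendsto_conv := by
    refine h.tendsto_conv.congr fun k => ?_
    rw [← pow_two, ← h.coeff_pow_mul_pow 2 k, pow_two, coeff_mul, spanSeries, coeff_mk,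
      mul_div_mul_right _ _ (h.radius_pow_pos _).ne']

theorem eventually_coeff_pos (h : IsSubexponential d g ρ) :
    ∀ᶠ n in multiplesAtTop d, 0 < coeff n g := by
  rw [multiplesAtTop_eq_map h.span_ne_zero, eventually_map]
  filter_upwards [h.isSubexponentialSeq_spanSeries.eventually_pos] with k hk
  rw [spanSeries, coeff_mk] at hk
  exact pos_of_mul_pos_left hk (h.radius_pow_pos _).le

theorem tendsto_coeff_sub_div (h : IsSubexponential d g ρ) {j : ℕ} (hj : d ∣ j) :
    Tendsto (fun n => coeff (n - j) g / coeff n g) (multiplesAtTop d) (𝓝 ((ρ : ℝ) ^ j)) := by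
  obtain ⟨i, rfl⟩ := hj
  rw [multiplesAtTop_eq_map h.span_ne_zero, tendsto_map'_iff, ← one_mul ((ρ : ℝ) ^ (d * i))]
  refine ((h.isSubexponentialSeq_spanSeries.tendsto_shift i).mul_const _).congr' ?_
  filter_upwards [eventually_ge_atTop i] with k hk
  obtain ⟨k, rfl⟩ := Nat.exists_eq_add_of_le' hk
  have hk := h.radius_pow_pos (d * k)
  have hi := h.radius_pow_pos (d * i)
  simp only [spanSeries, coeff_mk, Function.comp_apply, Nat.add_sub_cancel, mul_add, pow_add]
  field_simp

theorem tendsto_coeff_subst_div (h : IsSubexponential d g ρ) (hg : HasSubst g)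
    (hf : ENNReal.ofReal (seriesValue g ρ) < radiusOfConvergence f) :
    Tendsto (fun n => coeff n (f.subst g) / coeff n g) (multiplesAtTop d)
      (𝓝 (seriesValue (d⁄dX ℝ f) (seriesValue g ρ))) := by
  have hspan := h.isSubexponentialSeq_spanSeries
  set A := seriesValue g ρ
  have hsummable {y : ℝ} (hy : 0 ≤ y) (hyf : ENNReal.ofReal y < radiusOfConvergence f) :=
    hasSum_coeff_mul_natCast_mul_pow_iff.2 (summable_coeff_derivative_mul_pow hy hyf).hasSum
  obtain ⟨A', hAA', hA'f⟩ := ENNReal.lt_iff_exists_nnreal_btwn.1 hf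
  replace hAA' : A < A' := (ENNReal.ofReal_lt_coe_iff hspan.sum_pos.le).1 hAA'
  have hlim := hspan.tendsto_tsum_mul_pow hAA'
    (hsummable A'.coe_nonneg (by rwa [ENNReal.ofReal_coe_nnreal])).summable
  rw [(hsummable hspan.sum_pos.le hf).tsum_eq] at hlim
  rw [multiplesAtTop_eq_map h.span_ne_zero, tendsto_map'_iff]
  refine hlim.congr fun k => ?_
  simp only [← h.coeff_pow_mul_pow, ← mul_assoc, tsum_mul_right, Function.comp_apply,
    (hasSum_coeff_subst hg f (d * k)).tsum_eq]
  rw [spanSeries, coeff_mk, mul_div_mul_right _ _ (h.radius_pow_pos _).ne']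

end IsSubexponential

/-! ### Marked components -/

namespace SetPartition

variable {U : Type}

theorem subset_of_remove_eq {π π' : SetPartition U} {Q : Set U} (hQ : Q ∈ π.1) (hQ' : Q ∈ π'.1)
    (h : π.remove ⟨Q, hQ⟩ = π'.remove ⟨Q, hQ'⟩) : π.1 ⊆ π'.1 := by
  intro P hP
  obtain ⟨_ | R, hR⟩ := (π.unremove_bijective ⟨Q, hQ⟩).2 ⟨P, hP⟩
  · obtain rfl : Q = P := congrArg Subtype.val hR
    exact hQ'
  · obtain rfl : Subtype.val '' R.1 = P := congrArg Subtype.val hR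
    have hR' : R.1 ∈ (π'.remove ⟨Q, hQ'⟩).1 := h ▸ R.2
    exact hR'

theorem remove_injective {π π' : SetPartition U} {Q : Set U} (hQ : Q ∈ π.1) (hQ' : Q ∈ π'.1)
    (h : π.remove ⟨Q, hQ⟩ = π'.remove ⟨Q, hQ'⟩) : π = π' :=
  Subtype.ext ((subset_of_remove_eq hQ hQ' h).antisymm (subset_of_remove_eq hQ' hQ h.symm))

/-- The partition `p ∪ {Q}` of `U`, for a partition `p` of the complement of `Q`; it inverts
`SetPartition.remove`. -/
def insertClass (Q : Set U) (hQ : Q.Nonempty) (p : SetPartition ↥(Qᶜ)) : SetPartition U :=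
  ⟨insert Q ((Subtype.val '' ·) '' p.1), by
    constructor
    · rintro (h | ⟨P, hP, h⟩)
      · exact hQ.ne_empty h.symm
      · exact p.2.1 (Set.image_eq_empty.1 h ▸ hP)
    · intro x
      by_cases hx : x ∈ Q
      · refine ⟨Q, ⟨Set.mem_insert _ _, hx⟩, ?_⟩
        rintro _ ⟨rfl | ⟨P, -, rfl⟩, hxP⟩
        · rfl
        · obtain ⟨y, -, rfl⟩ := hxP
          exact absurd hx y.2
      · obtain ⟨P, ⟨hP, hxP⟩, hunique⟩ := p.2.2 ⟨x, hx⟩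
        refine ⟨Subtype.val '' P, ⟨Set.mem_insert_of_mem _ ⟨P, hP, rfl⟩, ⟨_, hxP, rfl⟩⟩, ?_⟩
        rintro _ ⟨rfl | ⟨P', hP', rfl⟩, hxP'⟩
        · exact absurd hxP' hx
        · obtain ⟨y, hy, rfl⟩ := hxP'
          exact congrArg (Subtype.val '' ·) (hunique P' ⟨hP', hy⟩)⟩

theorem remove_insertClass {Q : Set U} (hQ : Q.Nonempty) (p : SetPartition ↥(Qᶜ)) :
    (insertClass Q hQ p).remove ⟨Q, Set.mem_insert _ _⟩ = p := by
  refine Subtype.ext (Set.ext fun P => ⟨?_, fun hP => Set.mem_insert_of_mem _ ⟨P, hP, rfl⟩⟩)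
  rintro (hP | ⟨P', hP', hPP'⟩)
  · obtain ⟨x, hx⟩ := hQ
    have hQ_compl : Q ⊆ Qᶜ := hP.symm.subset.trans (Subtype.coe_image_subset Qᶜ P)
    exact absurd hx (hQ_compl hx)
  · rwa [← Subtype.val_injective.image_injective hPP']

theorem card_remove_add_one [Finite U] (π : SetPartition U) (Q : ↥π.1) :
    Nat.card ↥(π.remove Q).1 + 1 = Nat.card ↥π.1 := by
  rw [Nat.card_congr (π.removeEquiv Q), Finite.card_option]

theorem card_map {V : Type} (σ : U ≃ V) (π : SetPartition U) :
    Nat.card ↥(π.map σ).1 = Nat.card ↥π.1 :=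
  (Nat.card_congr (π.mapEquiv σ)).symm

theorem nonempty_classes [Nonempty U] (π : SetPartition U) : Nonempty ↥π.1 :=
  let ⟨Q, ⟨hQ, _⟩, _⟩ := π.2.2 (Classical.arbitrary U)
  ⟨⟨Q, hQ⟩⟩

theorem isEmpty_classes [IsEmpty U] (π : SetPartition U) : IsEmpty ↥π.1 :=
  ⟨fun Q => isEmptyElim (Setoid.nonempty_of_mem_partition π.2 Q.2).some⟩

instance [IsEmpty U] : Unique (SetPartition U) where
  default := ⟨∅, Set.notMem_empty _, isEmptyElim⟩
  uniq π := Subtype.ext (Set.isEmpty_coe_sort.1 π.isEmpty_classes)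

end SetPartition

namespace WeightedSpecies

/-- Transport of structures along a bijection, as a bijection. -/
def objEquiv (F : WeightedSpecies.{u}) {U V : Type} [Finite U] [Finite V] (σ : U ≃ V) :
    F.obj U ≃ F.obj V where
  toFun := F.map σ
  invFun := F.map σ.symm
  left_inv s := by rw [← F.map_trans, σ.self_trans_symm, F.map_refl]
  right_inv s := by rw [← F.map_trans, σ.symm_trans_self, F.map_refl]

namespace CompObj

variable {F : WeightedSpecies.{u}} {G : WeightedSpecies.{v}} {U : Type} [Finite U]

theorem mk_inj {π : SetPartition U} {o o' : F.obj ↥π.1} {i i' : ∀ Q : ↥π.1, G.obj ↥Q.1} :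
    CompObj.mk π o i = CompObj.mk π o' i' ↔ o = o' ∧ i = i' := by
  simp

theorem weight_remove_mul (s : CompObj F G U) (Q : ↥s.part.1) :
    (s.remove Q).weight * G.weight (s.inner Q) = s.weight := by
  have := Fintype.ofFinite ↥(s.part.remove Q).1
  have hinner : ∏ᶠ P : ↥s.part.1, G.weight (s.inner P) = G.weight (s.inner Q) *
      ∏ᶠ P : ↥(s.part.remove Q).1, G.weight ((s.remove Q).inner P) := by
    rw [← finprod_comp_equiv (s.part.removeEquiv Q).symm, finprod_eq_prod_of_fintype,
      Fintype.prod_option, finprod_eq_prod_of_fintype]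
    congr 1
    exact Finset.prod_congr rfl fun P _ => (G.weight_map _ _).symm
  have houter : F.derived.weight (s.remove Q).outer = F.weight s.outer := F.weight_map _ _
  rw [weight, weight, hinner, houter, mul_assoc, mul_comm (G.weight _)]
  rfl

/-- Deletion of the component `Q`, keeping the structure on it. -/
noncomputable def split (Q : Set U) (s : {s : CompObj F G U // Q ∈ s.part.1}) :
    CompObj F.derived G ↥(Qᶜ) × G.obj ↥Q :=
  (s.1.remove ⟨Q, s.2⟩, s.1.inner ⟨Q, s.2⟩)

theorem split_injective (Q : Set U) : Function.Injective (split (F := F) (G := G) Q) := by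
  rintro ⟨⟨π, o, i⟩, hQ⟩ ⟨⟨π', o', i'⟩, hQ'⟩ h
  obtain ⟨hremove, hinner⟩ := Prod.ext_iff.1 h
  obtain rfl : π = π' := SetPartition.remove_injective hQ hQ' (congrArg part hremove)
  obtain ⟨ho, hi⟩ := mk_inj.1 hremove
  obtain rfl : o = o' := (F.objEquiv (π.removeEquiv ⟨Q, hQ⟩)).injective ho
  obtain rfl : i = i' := by
    funext P
    obtain ⟨_ | P, rfl⟩ := (π.unremove_bijective ⟨Q, hQ⟩).2 P
    · exact hinner
    · exact (G.objEquiv _).injective (congrFun hi P)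
  rfl

theorem split_surjective (hG : IsEmpty (G.obj (Fin 0))) (Q : Set U) :
    Function.Surjective (split (F := F) (G := G) Q) := by
  rintro ⟨⟨p, o, i⟩, g⟩
  have hne : Q.Nonempty := by
    by_contra hQ
    have : IsEmpty ↥Q := Set.isEmpty_coe_sort.2 (Set.not_nonempty_iff_eq_empty.1 hQ)
    exact hG.false (G.map (Equiv.equivOfIsEmpty ↥Q (Fin 0)) g)
  obtain ⟨π, hQ, rfl⟩ : ∃ (π : SetPartition U) (hQ : Q ∈ π.1), π.remove ⟨Q, hQ⟩ = p :=
    ⟨_, _, SetPartition.remove_insertClass hne p⟩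
  let unremove := Equiv.ofBijective _ (π.unremove_bijective ⟨Q, hQ⟩)
  let innerAt : ∀ x, G.obj ↥(unremove x).1
    | none => g
    | some P => G.map (Equiv.Set.image Subtype.val P.1 Subtype.val_injective) (i P)
  let inner := Equiv.piCongrLeft (fun P : ↥π.1 => G.obj ↥P.1) unremove innerAt
  have hinner (x) : inner (unremove x) = innerAt x :=
    Equiv.piCongrLeft_apply_apply (fun P : ↥π.1 => G.obj ↥P.1) unremove innerAt x
  refine ⟨⟨⟨π, (F.objEquiv (π.removeEquiv ⟨Q, hQ⟩)).symm o, inner⟩, hQ⟩,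
    Prod.ext ?_ (hinner none)⟩
  refine mk_inj.2 ⟨(F.objEquiv (π.removeEquiv ⟨Q, hQ⟩)).apply_symm_apply o, funext fun P => ?_⟩
  exact (congrArg (G.map _) (hinner (some P))).trans ((G.objEquiv _).symm_apply_apply (i P))

/-- A composite structure with a marked component amounts to a set `Q` (the component), an
`F' ∘ G`-structure on the complement of `Q`, and a `G`-structure on `Q`. -/
noncomputable def markEquiv (hG : IsEmpty (G.obj (Fin 0))) :
    (Σ s : CompObj F G U, ↥s.part.1) ≃ Σ Q : Set U, CompObj F.derived G ↥(Qᶜ) × G.obj ↥Q :=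
  (⟨fun x => ⟨x.2.1, x.1, x.2.2⟩, fun x => ⟨x.2.1, x.1, x.2.2⟩, fun _ => rfl, fun _ => rfl⟩ :
    (Σ s : CompObj F G U, ↥s.part.1) ≃ Σ Q : Set U, {s : CompObj F G U // Q ∈ s.part.1}).trans
  (Equiv.sigmaCongrRight fun Q => Equiv.ofBijective (split Q)
    ⟨split_injective Q, split_surjective hG Q⟩)

theorem card_part_remainder {n : ℕ} (s : CompObj F G (Fin n)) (Q : ↥s.part.1) :
    Nat.card ↥((s.remainder Q).2 : CompObj F.derived G _).part.1 + 1 = Nat.card ↥s.part.1 := by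
  rw [← s.part.card_remove_add_one Q, ← SetPartition.card_map (relabel Q.1ᶜ)]
  rfl

/-- A composite structure on the empty set has no components. -/
noncomputable def equivOfIsEmpty (F : WeightedSpecies.{u}) (G : WeightedSpecies.{v}) (U : Type)
    [IsEmpty U] : CompObj F G U ≃ F.obj U :=
  have := SetPartition.isEmpty_classes (U := U)
  Equiv.ofBijective (fun s => F.map (Equiv.equivOfIsEmpty ↥s.part.1 U) s.outer) <| by
    constructor
    · rintro ⟨π, o, i⟩ ⟨π', o', i'⟩ h
      obtain rfl : π = π' := Subsingleton.elim _ _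
      obtain rfl : o = o' := (F.objEquiv _).injective h
      exact congrArg (CompObj.mk π o) (funext isEmptyElim)
    · intro o
      exact ⟨⟨default, (F.objEquiv (Equiv.equivOfIsEmpty _ U)).symm o, isEmptyElim⟩,
        (F.objEquiv _).apply_symm_apply o⟩

theorem weight_equivOfIsEmpty [IsEmpty U] (s : CompObj F G U) :
    F.weight (equivOfIsEmpty F G U s) = s.weight := by
  have := s.part.isEmpty_classes
  rw [weight, finprod_of_isEmpty, mul_one]
  exact F.weight_map _ _

end CompObj

end WeightedSpecies

/-! ### Generating series -/

theorem tsum_set_factorial_mul_coeff {U : Type*} [Finite U] {R : Type*} [CommSemiring R]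
    [TopologicalSpace R] (a b : PowerSeries R) :
    ∑' Q : Set U, ((Nat.card ↥Qᶜ)! * coeff (Nat.card ↥Qᶜ) a) *
        ((Nat.card ↥Q)! * coeff (Nat.card ↥Q) b) =
      (Nat.card U)! * coeff (Nat.card U) (a * b) := by
  classical
  have := Fintype.ofFinite U
  set n := Nat.card U with hn
  let term (k : ℕ) : R := ((n - k)! * coeff (n - k) a) * (k ! * coeff k b)
  have hterm (S : Finset U) : ((Nat.card ↥(Fintype.finsetEquivSet S)ᶜ)! *
      coeff (Nat.card ↥(Fintype.finsetEquivSet S)ᶜ) a) * ((Nat.card ↥(Fintype.finsetEquivSet S))! *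
        coeff (Nat.card ↥(Fintype.finsetEquivSet S)) b) = term S.card := by
    have hcard : Nat.card ↥(Fintype.finsetEquivSet S) = S.card := by simp
    have hcompl : Nat.card ↥(Fintype.finsetEquivSet S)ᶜ = n - S.card := by
      rw [Nat.card_coe_set_eq, Set.ncard_compl, ← Nat.card_coe_set_eq, hcard]
    rw [hcard, hcompl]
  have hchoose (k : ℕ) (hk : k ∈ Finset.range (n + 1)) :
      n.choose k • term k = n ! * (coeff k b * coeff (n - k) a) := by
    rw [← Nat.choose_mul_factorial_mul_factorial (Finset.mem_range_succ_iff.1 hk), nsmul_eq_mul]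
    simp only [term]
    push_cast
    ring
  rw [← (Fintype.finsetEquivSet (α := U)).tsum_eq, tsum_fintype, Finset.sum_congr rfl
    fun S _ => hterm S, ← Finset.powerset_univ, Finset.sum_powerset_apply_card,
    Finset.card_univ, ← Nat.card_eq_fintype_card, ← hn, Finset.sum_congr rfl hchoose,
    ← Finset.mul_sum, mul_comm a, coeff_mul,
    Finset.Nat.sum_antidiagonal_eq_sum_range_succ fun i j => coeff i b * coeff j a]

namespace WeightedSpecies

section Egs

variable (F : WeightedSpecies.{u})

/-- The exponential generating series `∑ ω(s) θ(s) z^|s| / |s|!`, in which every structure `s` is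
counted with an additional real weight `θ(s)`. -/
noncomputable def refinedEgs (θ : F.Structures → ℝ) : PowerSeries ℝ :=
  PowerSeries.mk fun n => (∑' s : F.obj (Fin n), F.weight s * θ ⟨n, s⟩) / n !

theorem refinedEgs_one : F.refinedEgs (fun _ => 1) = F.egs := by
  simp [refinedEgs, egs]

theorem tsum_weight_mul_map {U : Type} [Finite U] {m : ℕ} (σ : U ≃ Fin m)
    (θ : F.Structures → ℝ) :
    ∑' s : F.obj U, F.weight s * θ ⟨m, F.map σ s⟩ = m ! * coeff m (F.refinedEgs θ) := by
  rw [refinedEgs, coeff_mk, mul_div_cancel₀ _ (by positivity), ← (F.objEquiv σ).tsum_eq]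
  exact tsum_congr fun s => by rw [← F.weight_map σ s]; rfl

theorem tsum_weight {U : Type} [Finite U] {m : ℕ} (σ : U ≃ Fin m) :
    ∑' s : F.obj U, (F.weight s : ℝ) = m ! * coeff m F.egs := by
  simpa [refinedEgs_one] using F.tsum_weight_mul_map σ fun _ => 1

theorem coeff_egs_nonneg (n : ℕ) : 0 ≤ coeff n F.egs := by
  rw [egs, coeff_mk]
  positivity

theorem egs_derived : F.derived.egs = d⁄dX ℝ F.egs := by
  ext k
  have h : (k ! : ℝ) * coeff k F.derived.egs = (k + 1)! * coeff (k + 1) F.egs :=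
    (F.derived.tsum_weight (Equiv.refl _)).symm.trans (F.tsum_weight (finSuccEquiv k).symm)
  refine mul_left_cancel₀ (by positivity : (k ! : ℝ) ≠ 0) ?_
  rw [h, coeff_derivative, Nat.factorial_succ]
  push_cast
  ring

variable {F}

theorem hasSubst_egs (hF : IsEmpty (F.obj (Fin 0))) : HasSubst F.egs :=
  HasSubst.of_constantCoeff_zero' <| by simp [← coeff_zero_eq_constantCoeff_apply, egs]

theorem weight_eq_zero_of_coeff_egs_eq_zero {n : ℕ} (h : coeff n F.egs = 0) (s : F.obj (Fin n)) :
    F.weight s = 0 := by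
  have := Fintype.ofFinite (F.obj (Fin n))
  have hsum := F.tsum_weight (Equiv.refl (Fin n))
  rw [h, mul_zero, tsum_fintype, Finset.sum_eq_zero_iff_of_nonneg fun _ _ => NNReal.coe_nonneg _]
    at hsum
  exact_mod_cast hsum s (Finset.mem_univ s)

end Egs

section Comp

variable {F : WeightedSpecies.{u}} {G : WeightedSpecies.{v}}

theorem CompObj.tsum_marked {U : Type} [Finite U] (hG : IsEmpty (G.obj (Fin 0)))
    (ξ : ∀ Q : Set U, CompObj F.derived G ↥Qᶜ → ℝ) :
    ∑' s : CompObj F G U, ∑' Q : ↥s.part.1, s.weight * ξ Q.1 (s.remove Q) =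
      ∑' Q : Set U, (∑' r : CompObj F.derived G ↥Qᶜ, r.weight * ξ Q r) *
        ∑' g : G.obj ↥Q, (G.weight g : ℝ) := by
  have (U : Type) [Finite U] : Finite (CompObj F G U) := CompObj.finite U
  have (U : Type) [Finite U] : Finite (CompObj F.derived G U) := CompObj.finite U
  calc _ = ∑' x : Σ s : CompObj F G U, ↥s.part.1, x.1.weight * ξ x.2.1 (x.1.remove x.2) :=
        Summable.of_finite.tsum_sigma.symm
    _ = ∑' y : Σ Q : Set U, CompObj F.derived G ↥Qᶜ × G.obj ↥Q,
          (y.2.1.weight * G.weight y.2.2 : ℝ≥0) * ξ y.1 y.2.1 := by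
        rw [← (markEquiv hG).tsum_eq]
        exact tsum_congr fun x => by rw [← x.1.weight_remove_mul x.2]; rfl
    _ = _ := by
        rw [Summable.of_finite.tsum_sigma]
        refine tsum_congr fun Q => ?_
        rw [Summable.of_finite.tsum_mul_tsum .of_finite .of_finite]
        exact tsum_congr fun x => by push_cast; ring

theorem tsum_remainder (hG : IsEmpty (G.obj (Fin 0))) (n : ℕ)
    (θ : (F.derived.comp G).Structures → ℝ) :
    ∑' s : CompObj F G (Fin n), ∑' Q : ↥s.part.1, s.weight * θ (s.remainder Q) =
      n ! * coeff n ((F.derived.comp G).refinedEgs θ * G.egs) := by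
  have hsplit (Q : Set (Fin n)) :=
    congrArg₂ (· * ·) ((F.derived.comp G).tsum_weight_mul_map (relabel Qᶜ) θ)
      (G.tsum_weight (Finite.equivFin ↥Q))
  have hconv := tsum_set_factorial_mul_coeff (U := Fin n) ((F.derived.comp G).refinedEgs θ) G.egs
  rw [Nat.card_fin] at hconv
  rw [← hconv, ← tsum_congr hsplit]
  exact CompObj.tsum_marked hG fun Q r => θ ⟨_, r.map (relabel Qᶜ)⟩

/-- The exponential generating series of the `F ∘ G`-structures with exactly `k` components. -/
noncomputable def componentEgs (F : WeightedSpecies.{u}) (G : WeightedSpecies.{v}) (k : ℕ) :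
    PowerSeries ℝ :=
  (F.comp G).refinedEgs fun s => if Nat.card ↥(s.2 : CompObj F G _).part.1 = k then 1 else 0

theorem componentEgs_zero : F.componentEgs G 0 = C (coeff 0 F.egs) := by
  ext n
  rw [componentEgs, refinedEgs, coeff_mk, coeff_C]
  rcases n with _ | n
  · rw [if_pos rfl, egs, coeff_mk, ← (CompObj.equivOfIsEmpty F G (Fin 0)).tsum_eq]
    congr 1
    refine tsum_congr fun s : CompObj F G (Fin 0) => ?_
    have := s.part.isEmpty_classes
    rw [if_pos Nat.card_of_isEmpty, mul_one, CompObj.weight_equivOfIsEmpty]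
    rfl
  · have hterm (s : CompObj F G (Fin (n + 1))) :
        (s.weight : ℝ) * (if Nat.card ↥s.part.1 = 0 then 1 else 0) = 0 := by
      have := s.part.nonempty_classes
      rw [if_neg Nat.card_pos.ne', mul_zero]
    rw [if_neg n.succ_ne_zero, div_eq_zero_iff]
    exact Or.inl ((tsum_congr hterm).trans tsum_zero)

/-- Both sides count the `F ∘ G`-structures with `k + 1` components, one of which is marked. -/
theorem add_one_mul_componentEgs_add_one (hG : IsEmpty (G.obj (Fin 0))) (k : ℕ) :
    C ((k : ℝ) + 1) * F.componentEgs G (k + 1) = F.derived.componentEgs G k * G.egs := by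
  ext n
  refine mul_left_cancel₀ (by positivity : (n ! : ℝ) ≠ 0) ?_
  have hmarks (s : CompObj F G (Fin n)) : ∑' Q : ↥s.part.1, (s.weight : ℝ) *
      (if Nat.card ↥((s.remainder Q).2 : CompObj F.derived G _).part.1 = k then 1 else 0) =
      (k + 1) * (s.weight * if Nat.card ↥s.part.1 = k + 1 then 1 else 0) := by
    have hcard (Q : ↥s.part.1) :
        Nat.card ↥((s.remainder Q).2 : CompObj F.derived G _).part.1 = k ↔
          Nat.card ↥s.part.1 = k + 1 := by
      rw [← s.card_part_remainder Q, Nat.add_right_cancel_iff]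
    simp only [hcard, tsum_const, nsmul_eq_mul]
    split_ifs with hk
    · rw [hk]
      push_cast
      ring
    · simp only [mul_zero]
  calc (n ! : ℝ) * coeff n (C ((k : ℝ) + 1) * F.componentEgs G (k + 1)) =
        (k + 1) * ∑' s : CompObj F G (Fin n),
          (s.weight : ℝ) * if Nat.card ↥s.part.1 = k + 1 then 1 else 0 := by
        rw [coeff_C_mul, mul_left_comm, componentEgs,
          ← (F.comp G).tsum_weight_mul_map (Equiv.refl _)]
        simp only [(F.comp G).map_refl]
        rfl
    _ = ∑' s : CompObj F G (Fin n), ∑' Q : ↥s.part.1, (s.weight : ℝ) *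
          if Nat.card ↥((s.remainder Q).2 : CompObj F.derived G _).part.1 = k then 1 else 0 := by
        rw [tsum_congr hmarks, tsum_mul_left]
    _ = n ! * coeff n (F.derived.componentEgs G k * G.egs) :=
        tsum_remainder hG n fun R =>
          if Nat.card ↥(R.2 : CompObj F.derived G _).part.1 = k then 1 else 0

theorem componentEgs_eq (hG : IsEmpty (G.obj (Fin 0))) (k : ℕ) :
    F.componentEgs G k = C (coeff k F.egs) * G.egs ^ k := by
  induction k generalizing F with
  | zero => rw [componentEgs_zero, pow_zero, mul_one]
  | succ k ih =>
    have hk : (C ((k : ℝ) + 1) : PowerSeries ℝ) ≠ 0 := by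
      rw [Ne, map_eq_zero_iff _ C_injective]
      positivity
    refine mul_left_cancel₀ hk ?_
    rw [add_one_mul_componentEgs_add_one hG, ih, egs_derived, coeff_derivative, map_mul]
    ring

theorem hasSum_coeff_componentEgs (n : ℕ) :
    HasSum (fun k => coeff n (F.componentEgs G k)) (coeff n (F.comp G).egs) := by
  have hterm (s : CompObj F G (Fin n)) : HasSum
      (fun k => (s.weight : ℝ) * if Nat.card ↥s.part.1 = k then 1 else 0) s.weight := by
    convert hasSum_single (Nat.card ↥s.part.1) fun k hk => ?_
    · rw [if_pos rfl, mul_one]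
    · rw [if_neg hk.symm, mul_zero]
  have := Fintype.ofFinite ((F.comp G).obj (Fin n))
  simp only [componentEgs, refinedEgs, egs, coeff_mk, tsum_fintype]
  exact (hasSum_sum fun s _ => hterm s).div_const _

theorem egs_comp (hG : IsEmpty (G.obj (Fin 0))) : (F.comp G).egs = F.egs.subst G.egs := by
  ext n
  refine (hasSum_coeff_componentEgs n).unique ?_
  simp only [componentEgs_eq hG, coeff_C_mul]
  exact hasSum_coeff_subst (hasSubst_egs hG) F.egs n

end Comp

end WeightedSpecies

/-! ### Total variation -/

section TotalVariation

variable {S : Type u}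

theorem toOuterMeasure_ne_top (p : PMF S) (E : Set S) : p.toOuterMeasure E ≠ ∞ := by
  rw [PMF.toOuterMeasure_apply]
  exact ne_top_of_le_ne_top p.tsum_coe_ne_top
    (ENNReal.tsum_le_tsum fun x => Set.indicator_le_self E p x)

theorem toReal_toOuterMeasure_sub_le (p q : PMF S) (E : Set S) :
    (q.toOuterMeasure E).toReal - (p.toOuterMeasure E).toReal ≤ (∑' x, (q x - p x)).toReal := by
  have hdefect : ∑' x, (q x - p x) ≠ ∞ :=
    ne_top_of_le_ne_top q.tsum_coe_ne_top (ENNReal.tsum_le_tsum fun x => tsub_le_self)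
  have hp := toOuterMeasure_ne_top p E
  rw [sub_le_iff_le_add, ← ENNReal.toReal_add hdefect hp]
  refine ENNReal.toReal_mono (ENNReal.add_ne_top.2 ⟨hdefect, hp⟩) ?_
  rw [PMF.toOuterMeasure_apply, PMF.toOuterMeasure_apply, ← ENNReal.tsum_add]
  refine ENNReal.tsum_le_tsum fun x => ?_
  by_cases hx : x ∈ E
  · simpa only [Set.indicator_of_mem hx] using le_tsub_add
  · simp only [Set.indicator_of_notMem hx, zero_le]

theorem toReal_toOuterMeasure_compl (p : PMF S) (E : Set S) :
    (p.toOuterMeasure Eᶜ).toReal = 1 - (p.toOuterMeasure E).toReal := by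
  have h : p.toOuterMeasure E + p.toOuterMeasure Eᶜ = 1 := by
    rw [PMF.toOuterMeasure_apply, PMF.toOuterMeasure_apply, ← ENNReal.tsum_add, ← p.tsum_coe]
    exact tsum_congr fun x => Set.indicator_self_add_compl_apply E p x
  rw [← ENNReal.toReal_one, ← h,
    ENNReal.toReal_add (toOuterMeasure_ne_top p E) (toOuterMeasure_ne_top p Eᶜ),
    add_sub_cancel_left]

theorem totalVariationDist_le (p q : PMF S) :
    totalVariationDist p q ≤ (∑' x, (q x - p x)).toReal := by
  refine ciSup_le fun E => abs_le.2 ⟨?_, ?_⟩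
  · linarith [toReal_toOuterMeasure_sub_le p q E]
  · have hcompl := toReal_toOuterMeasure_sub_le p q Eᶜ
    rw [toReal_toOuterMeasure_compl, toReal_toOuterMeasure_compl] at hcompl
    linarith

theorem totalVariationDist_nonneg (p q : PMF S) : 0 ≤ totalVariationDist p q :=
  Real.iSup_nonneg fun _ => abs_nonneg _

/-- Scheffé's lemma: the mass of `q` that `p i` misses is dominated by `q`. -/
theorem tendsto_totalVariationDist {ι : Type*} {l : Filter ι} {p : ι → PMF S} {q : PMF S}
    (h : ∀ x, Tendsto (fun i => p i x) l (𝓝 (q x))) :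
    Tendsto (fun i => totalVariationDist (p i) q) l (𝓝 0) := by
  refine squeeze_zero (fun i => totalVariationDist_nonneg _ _)
    (fun i => totalVariationDist_le _ _) ?_
  have hdefect_top (i x) : q x - p i x ≠ ∞ := ne_top_of_le_ne_top (q.apply_ne_top x) tsub_le_self
  have hdefect (x) : Tendsto (fun i => (q x - p i x).toReal) l (𝓝 0) := by
    have hsub := ENNReal.Tendsto.sub (tendsto_const_nhds (x := q x)) (h x)
      (Or.inl (q.apply_ne_top x))
    rw [tsub_self] at hsub
    simpa [Function.comp_def] using (ENNReal.tendsto_toReal ENNReal.zero_ne_top).comp hsub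
  simp_rw [ENNReal.tsum_toReal_eq (hdefect_top _)]
  rw [← tsum_zero (β := S)]
  refine tendsto_tsum_of_dominated_convergence (bound := fun x => (q x).toReal)
    (ENNReal.summable_toReal q.tsum_coe_ne_top) hdefect (Eventually.of_forall fun i x => ?_)
  rw [Real.norm_of_nonneg ENNReal.toReal_nonneg]
  exact ENNReal.toReal_mono (q.apply_ne_top x) tsub_le_self

end TotalVariation

/-! ### The laws of the remainder and of the Boltzmann structure -/

namespace WeightedSpecies

section Laws

variable {F : WeightedSpecies.{u}} {G : WeightedSpecies.{v}}

theorem tsum_coe_weight (n : ℕ) :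
    ∑' s : F.obj (Fin n), (F.weight s : ℝ≥0∞) = ENNReal.ofReal (n ! * coeff n F.egs) := by
  rw [← F.tsum_weight (Equiv.refl (Fin n)),
    ENNReal.ofReal_tsum_of_nonneg (fun _ => NNReal.coe_nonneg _) .of_finite]
  simp only [ENNReal.ofReal_coe_nnreal]

theorem toReal_gibbs_apply {n : ℕ} (hn : 0 < coeff n F.egs) (s : F.obj (Fin n)) :
    (F.gibbs n hn s).toReal = F.weight s / (n ! * coeff n F.egs) := by
  rw [gibbs, PMF.normalize_apply, tsum_coe_weight, ENNReal.toReal_mul, ENNReal.toReal_inv,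
    ENNReal.toReal_ofReal (by positivity), ENNReal.coe_toReal, div_eq_mul_inv]

theorem CompObj.largest_eq_singleton {U : Type} [Finite U] (s : CompObj F G U) (Q₀ : ↥s.part.1)
    (h : Nat.card ↥Q₀.1ᶜ < Nat.card ↥Q₀.1) : s.largest = {Q₀} := by
  have hlt (Q : ↥s.part.1) (hne : Q ≠ Q₀) : Nat.card ↥Q.1 < Nat.card ↥Q₀.1 :=
    (Nat.card_mono (Set.toFinite _) fun x hx hx₀ => hne <| Subtype.ext <|
      (s.part.2.2 x).unique ⟨Q.2, hx⟩ ⟨Q₀.2, hx₀⟩).trans_lt h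
  ext Q
  simp only [largest, Set.Finite.mem_toFinset, Set.mem_ofPred_eq, Finset.mem_singleton]
  constructor
  · intro hQ
    by_contra hne
    exact (hlt Q hne).not_ge (hQ Q₀)
  · rintro rfl Q'
    rcases eq_or_ne Q' Q with rfl | hne
    · rfl
    · exact (hlt Q' hne).le

theorem CompObj.uniform_largest_map_remainder_apply {n : ℕ} (s : CompObj F G (Fin n))
    (hs : s.largest.Nonempty) (R : (F.derived.comp G).Structures) (hR : 2 * R.1 < n) :
    ((PMF.uniformOfFinset s.largest hs).map fun Q₀ => s.remainder Q₀) R =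
      ∑' Q : ↥s.part.1, Set.indicator {R} 1 (s.remainder Q) := by
  classical
  rw [PMF.map_apply]
  refine tsum_congr fun Q => ?_
  simp only [eq_comm (a := R), Set.indicator_apply, Set.mem_singleton_iff, Pi.one_apply]
  refine if_ctx_congr Iff.rfl (fun hQ => ?_) fun _ => rfl
  have hcompl : Nat.card ↥Q.1ᶜ = R.1 := congrArg Sigma.fst hQ
  have hadd : Nat.card ↥Q.1 + Nat.card ↥Q.1ᶜ = n := by
    rw [Nat.card_coe_set_eq, Nat.card_coe_set_eq, Set.ncard_add_ncard_compl, Nat.card_fin]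
  have hlargest : s.largest = {Q} := s.largest_eq_singleton Q (by omega)
  simp [PMF.uniformOfFinset_apply, hlargest]

theorem refinedEgs_indicator_singleton (R : F.Structures) :
    F.refinedEgs (Set.indicator {R} 1) = C (F.weight R.2 / R.1 ! : ℝ) * X ^ R.1 := by
  obtain ⟨m, r⟩ := R
  ext n
  rw [refinedEgs, coeff_mk, coeff_C_mul, coeff_X_pow]
  have hne {s : F.obj (Fin n)} (h : (⟨n, s⟩ : F.Structures) ≠ ⟨m, r⟩) :
      (F.weight s : ℝ) * Set.indicator {(⟨m, r⟩ : F.Structures)} 1 (⟨n, s⟩ : F.Structures) = 0 :=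
    mul_eq_zero_of_right _ (Set.indicator_of_notMem (Set.notMem_singleton_iff.2 h) _)
  rcases eq_or_ne n m with rfl | hnm
  · have heq : (F.weight r : ℝ) *
        Set.indicator {(⟨n, r⟩ : F.Structures)} 1 (⟨n, r⟩ : F.Structures) = F.weight r :=
      (congrArg _ (Set.indicator_of_mem (Set.mem_singleton _) _)).trans (mul_one _)
    rw [if_pos rfl, mul_one]
    exact congrArg (· / (n ! : ℝ)) <|
      (tsum_eq_single r fun s hs => hne fun h => hs (eq_of_heq (Sigma.mk.inj h).2)).trans heq
  · rw [if_neg hnm, mul_zero, div_eq_zero_iff]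
    exact .inl <| (tsum_congr fun s => hne fun h => hnm (congrArg Sigma.fst h)).trans tsum_zero

theorem toReal_remainderLaw_apply_eq_tsum {n : ℕ} (hpos : 0 < n)
    (hn : 0 < coeff n (F.comp G).egs) (R : (F.derived.comp G).Structures) (hR : 2 * R.1 < n) :
    (remainderLaw F G n hpos hn R).toReal =
      (∑' s : CompObj F G (Fin n), ∑' Q : ↥s.part.1,
        (s.weight : ℝ) * Set.indicator {R} 1 (s.remainder Q)) /
          (n ! * coeff n (F.comp G).egs) := by
  have : Nonempty (Fin n) := ⟨⟨0, hpos⟩⟩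
  refine (congrArg ENNReal.toReal (PMF.bind_apply _ _ R)).trans ?_
  rw [ENNReal.tsum_toReal_eq
    fun s => ENNReal.mul_ne_top (PMF.apply_ne_top _ _) (PMF.apply_ne_top _ _), ← tsum_div_const]
  refine tsum_congr fun s : CompObj F G (Fin n) => ?_
  have hgibbs : ((F.comp G).gibbs n hn s).toReal = s.weight / (n ! * coeff n (F.comp G).egs) :=
    toReal_gibbs_apply hn s
  have hindicator (R' : (F.derived.comp G).Structures) :
      (Set.indicator {R} 1 R' : ℝ≥0∞).toReal = Set.indicator {R} 1 R' := by
    by_cases h : R' ∈ ({R} : Set (F.derived.comp G).Structures) <;> simp [h]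
  rw [s.uniform_largest_map_remainder_apply s.largest_nonempty R hR, ENNReal.toReal_mul,
    ENNReal.tsum_toReal_eq fun Q => ?_, hgibbs, tsum_mul_left, div_mul_eq_mul_div]
  · simp only [hindicator]
  · exact ne_top_of_le_ne_top ENNReal.one_ne_top
      (Set.indicator_le_self' (f := 1) (fun _ _ => zero_le) (s.remainder Q))

theorem toReal_remainderLaw_apply (hG : IsEmpty (G.obj (Fin 0))) {n : ℕ} (hpos : 0 < n)
    (hn : 0 < coeff n (F.comp G).egs) (R : (F.derived.comp G).Structures) (hR : 2 * R.1 < n) :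
    (remainderLaw F G n hpos hn R).toReal = ((F.derived.comp G).weight R.2 / R.1 ! : ℝ) *
      (coeff (n - R.1) G.egs / coeff n (F.comp G).egs) := by
  rw [toReal_remainderLaw_apply_eq_tsum hpos hn R hR, tsum_remainder hG n (Set.indicator {R} 1),
    mul_div_mul_left _ _ (by positivity), refinedEgs_indicator_singleton, mul_assoc, coeff_C_mul,
    coeff_X_pow_mul', if_pos (by omega), mul_div_assoc]

theorem toReal_boltzmannWeight (y : ℝ≥0) (s : F.Structures) :
    (F.boltzmannWeight y s).toReal = (F.weight s.2 / s.1 ! : ℝ) * (y : ℝ) ^ s.1 := by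
  rw [boltzmannWeight, ENNReal.coe_toReal]
  push_cast
  ring

theorem tsum_boltzmannWeight {y : ℝ≥0} {Z : ℝ}
    (hZ : HasSum (fun n => coeff n F.egs * (y : ℝ) ^ n) Z) :
    ∑' s, F.boltzmannWeight y s = ENNReal.ofReal Z := by
  have hlevel (n : ℕ) : ∑' s : F.obj (Fin n), F.boltzmannWeight y ⟨n, s⟩ =
      ENNReal.ofReal (coeff n F.egs * (y : ℝ) ^ n) := by
    have hterm (s : F.obj (Fin n)) :
        F.boltzmannWeight y ⟨n, s⟩ = F.weight s * ((y ^ n / n ! : ℝ≥0) : ℝ≥0∞) := by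
      change ((F.weight s * y ^ n / (n ! : ℝ≥0) : ℝ≥0) : ℝ≥0∞) = _
      rw [mul_div_assoc, ENNReal.coe_mul]
    rw [tsum_congr hterm, ENNReal.tsum_mul_right, tsum_coe_weight, ← ENNReal.ofReal_coe_nnreal,
      ← ENNReal.ofReal_mul' (NNReal.coe_nonneg _)]
    push_cast
    field_simp
  rw [← hZ.tsum_eq, ENNReal.ofReal_tsum_of_nonneg
    (fun n => mul_nonneg (F.coeff_egs_nonneg n) (by positivity)) hZ.summable]
  exact (ENNReal.tsum_sigma' _).trans (tsum_congr hlevel)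

theorem toReal_boltzmann_apply {y : ℝ≥0} {Z : ℝ}
    (hZ : HasSum (fun n => coeff n F.egs * (y : ℝ) ^ n) Z) (h : F.IsBoltzmannParameter y)
    (s : F.Structures) :
    (F.boltzmann y h s).toReal = (F.weight s.2 / s.1 ! : ℝ) * ((y : ℝ) ^ s.1 / Z) := by
  have hZ₀ : 0 ≤ Z := hZ.nonneg fun n => mul_nonneg (F.coeff_egs_nonneg n) (by positivity)
  rw [boltzmann, PMF.normalize_apply, tsum_boltzmannWeight hZ, ENNReal.toReal_mul,
    toReal_boltzmannWeight, ENNReal.toReal_inv, ENNReal.toReal_ofReal hZ₀, mul_assoc,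
    div_eq_mul_inv _ Z]

end Laws

end WeightedSpecies

/-! ### Limits -/

namespace WeightedSpecies

section Limit

variable {F : WeightedSpecies.{u}} {G : WeightedSpecies.{v}} {d : ℕ} {ρ : ℝ≥0}

theorem seriesValue_derivative_egs_pos (hF : ∃ k : ℕ, 1 ≤ k ∧ 0 < coeff k F.egs)
    (hsub : IsSubexponential d G.egs ρ)
    (hrad : ENNReal.ofReal (seriesValue G.egs ρ) < radiusOfConvergence F.egs) :
    0 < seriesValue (d⁄dX ℝ F.egs) (seriesValue G.egs ρ) :=
  seriesValue_derivative_pos F.coeff_egs_nonneg hF hsub.isSubexponentialSeq_spanSeries.sum_pos hrad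

theorem hasSum_coeff_egs_derived_comp (hG : IsEmpty (G.obj (Fin 0)))
    (hsub : IsSubexponential d G.egs ρ)
    (hrad : ENNReal.ofReal (seriesValue G.egs ρ) < radiusOfConvergence F.egs) :
    HasSum (fun n => coeff n (F.derived.comp G).egs * (ρ : ℝ) ^ n)
      (seriesValue (d⁄dX ℝ F.egs) (seriesValue G.egs ρ)) := by
  rw [egs_comp hG, ← egs_derived]
  refine hasSum_coeff_subst_mul_pow (hasSubst_egs hG) F.derived.coeff_egs_nonneg G.coeff_egs_nonneg
    ρ.coe_nonneg hsub.hasSum ?_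
  rw [egs_derived]
  exact (summable_coeff_derivative_mul_pow hsub.isSubexponentialSeq_spanSeries.sum_pos.le
    hrad).hasSum

theorem isBoltzmannParameter_derived_comp (hG : IsEmpty (G.obj (Fin 0)))
    (hF : ∃ k : ℕ, 1 ≤ k ∧ 0 < coeff k F.egs) (hsub : IsSubexponential d G.egs ρ)
    (hrad : ENNReal.ofReal (seriesValue G.egs ρ) < radiusOfConvergence F.egs) :
    (F.derived.comp G).IsBoltzmannParameter ρ := by
  rw [IsBoltzmannParameter, tsum_boltzmannWeight (hasSum_coeff_egs_derived_comp hG hsub hrad)]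
  exact ⟨(ENNReal.ofReal_pos.2 (seriesValue_derivative_egs_pos hF hsub hrad)).ne',
    ENNReal.ofReal_ne_top⟩

theorem eventually_coeff_egs_comp_pos (hG : IsEmpty (G.obj (Fin 0)))
    (hF : ∃ k : ℕ, 1 ≤ k ∧ 0 < coeff k F.egs) (hsub : IsSubexponential d G.egs ρ)
    (hrad : ENNReal.ofReal (seriesValue G.egs ρ) < radiusOfConvergence F.egs) :
    ∀ᶠ n in multiplesAtTop d, 0 < coeff n (F.comp G).egs := by
  have hratio := hsub.tendsto_coeff_subst_div (hasSubst_egs hG) hrad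
  filter_upwards [hsub.eventually_coeff_pos,
    hratio.eventually_const_lt (seriesValue_derivative_egs_pos hF hsub hrad)] with n hn hpos
  rw [egs_comp hG]
  exact (div_pos_iff_of_pos_right hn).1 hpos

theorem tendsto_coeff_egs_sub_div_coeff_egs_comp (hG : IsEmpty (G.obj (Fin 0)))
    (hF : ∃ k : ℕ, 1 ≤ k ∧ 0 < coeff k F.egs) (hsub : IsSubexponential d G.egs ρ)
    (hrad : ENNReal.ofReal (seriesValue G.egs ρ) < radiusOfConvergence F.egs) {j : ℕ}
    (hj : d ∣ j) :
    Tendsto (fun n => coeff (n - j) G.egs / coeff n (F.comp G).egs) (multiplesAtTop d)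
      (𝓝 ((ρ : ℝ) ^ j / seriesValue (d⁄dX ℝ F.egs) (seriesValue G.egs ρ))) := by
  refine ((hsub.tendsto_coeff_sub_div hj).div
    (hsub.tendsto_coeff_subst_div (hasSubst_egs hG) hrad)
    (seriesValue_derivative_egs_pos hF hsub hrad).ne').congr' ?_
  filter_upwards [hsub.eventually_coeff_pos] with n hn
  rw [egs_comp hG, Pi.div_apply, div_div_div_cancel_right₀ hn.ne']

theorem weight_comp_eq_zero_of_not_dvd (hG : IsEmpty (G.obj (Fin 0)))
    (hsub : IsSubexponential d G.egs ρ) {n : ℕ} (hn : ¬ d ∣ n) (s : (F.comp G).obj (Fin n)) :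
    (F.comp G).weight s = 0 :=
  weight_eq_zero_of_coeff_egs_eq_zero
    (by rw [egs_comp hG, hsub.coeff_subst_eq_zero (hasSubst_egs hG) _ hn]) s

theorem tendsto_remainderLaw_apply (hG : IsEmpty (G.obj (Fin 0)))
    (hF : ∃ k : ℕ, 1 ≤ k ∧ 0 < coeff k F.egs) (hsub : IsSubexponential d G.egs ρ)
    (hrad : ENNReal.ofReal (seriesValue G.egs ρ) < radiusOfConvergence F.egs)
    (hR : (F.derived.comp G).IsBoltzmannParameter ρ) (R : (F.derived.comp G).Structures) :
    Tendsto (fun n : {n // 0 < n ∧ 0 < coeff n (F.comp G).egs} =>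
        remainderLaw F G n n.2.1 n.2.2 R)
      (comap (↑) (multiplesAtTop d)) (𝓝 ((F.derived.comp G).boltzmann ρ hR R)) := by
  rw [← ENNReal.tendsto_toReal_iff (fun _ => PMF.apply_ne_top _ _) (PMF.apply_ne_top _ _),
    toReal_boltzmann_apply (hasSum_coeff_egs_derived_comp hG hsub hrad)]
  have hlarge : ∀ᶠ n in multiplesAtTop d, 2 * R.1 < n :=
    (eventually_gt_atTop (2 * R.1)).filter_mono inf_le_left
  have hlimit : Tendsto (fun n => ((F.derived.comp G).weight R.2 / R.1 ! : ℝ) *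
      (coeff (n - R.1) G.egs / coeff n (F.comp G).egs)) (multiplesAtTop d)
      (𝓝 (((F.derived.comp G).weight R.2 / R.1 ! : ℝ) *
        ((ρ : ℝ) ^ R.1 / seriesValue (d⁄dX ℝ F.egs) (seriesValue G.egs ρ)))) := by
    by_cases hd : d ∣ R.1
    · exact (tendsto_coeff_egs_sub_div_coeff_egs_comp hG hF hsub hrad hd).const_mul _
    · simp only [weight_comp_eq_zero_of_not_dvd hG hsub hd, NNReal.coe_zero, zero_div, zero_mul]
      exact tendsto_const_nhds
  refine (hlimit.comp tendsto_comap).congr' ?_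
  filter_upwards [tendsto_comap.eventually hlarge] with n hn
  exact (toReal_remainderLaw_apply hG n.2.1 n.2.2 R hn).symm

end Limit

end WeightedSpecies

theorem theorem3p1 (F : WeightedSpecies.{u}) (G : WeightedSpecies.{v})
    (hG : IsEmpty (G.obj (Fin 0)))
    (hF : ∃ k : ℕ, 1 ≤ k ∧ 0 < PowerSeries.coeff k F.egs)
    (d : ℕ) (ρ : ℝ≥0) (hsub : IsSubexponential d G.egs ρ)
    (hrad : ENNReal.ofReal (seriesValue G.egs ρ) < radiusOfConvergence F.egs) :
    ∃ hR : (F.derived.comp G).IsBoltzmannParameter ρ,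
      ∀ ε : ℝ, 0 < ε → ∀ᶠ n : ℕ in Filter.atTop, d ∣ n →
        ∃ (hpos : 0 < n) (hn : 0 < PowerSeries.coeff n (F.comp G).egs),
          totalVariationDist (WeightedSpecies.remainderLaw F G n hpos hn)
            ((F.derived.comp G).boltzmann ρ hR) < ε := by
  have hR := WeightedSpecies.isBoltzmannParameter_derived_comp hG hF hsub hrad
  refine ⟨hR, fun ε hε => ?_⟩
  have htv := tendsto_totalVariationDist
    (WeightedSpecies.tendsto_remainderLaw_apply hG hF hsub hrad hR)
  have hclose := eventually_comap.1 (htv.eventually_lt_const hε)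
  have hcoeff := WeightedSpecies.eventually_coeff_egs_comp_pos hG hF hsub hrad
  filter_upwards [eventually_inf_principal.1 hclose, eventually_inf_principal.1 hcoeff,
    eventually_gt_atTop 0] with n hlt hn hpos hdvd
  exact ⟨hpos, hn hdvd, hlt hdvd ⟨n, hpos, hn hdvd⟩ rfl⟩
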